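/- Setting. Let $\mathfrak g$ be the Lie algebra of a complex simple algebraic group $G$, with commuting conjugate-linear involutive automorphisms $\sigma,\theta$ such that $\mathfrak g_u=\mathfrak g^\theta$ is compact (the Killing form is negative definite on it). Put $\mathfrak k=\mathfrak g^{\sigma\theta}$, let $\mathfrak m$ be the $(-1)$-eigenspace of $\sigma\theta$, $\mathfrak k_0=\{X:\sigma X=X=\theta X\}$, $\mathfrak m_0=\{X:\sigma X=X,\ \theta X=-X\}$. Assume the symmetric space $G_u/K_0$ is Hermitian, i.e. $\mathfrak m\ne0$ and there is an element $\Upsilon$ of the centre of $\mathfrak k_0$ such that $J:=\mathrm{ad}_\Upsilon$ acts on $\mathfrak m$ with eigenvalues $\pm i$, $J^2=-I$; fix such an $\Upsilon$. Let $\mathfrak m^+$ be the $i$-eigenspace of $J$ on $\mathfrak m$. For $Z\in\mathfrak m$ put $$E_Z=\sum_{n\ge0}\frac{\mathrm{ad}_Z^{2n}}{(2n+1)!},\qquad S_Z=\tfrac12\left(\mathrm{Ad}_{\exp Z}+\mathrm{Ad}_{\exp Z}^{-1}\right),\qquad \mathrm{Ad}_{\exp Z}=e^{\mathrm{ad}_Z}.$$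 (1) Let $Z,A\in\mathfrak m_0$, $A\neq0$, and $\nu_1,\nu_2\in\mathbb R$ with $\mathrm{ad}_Z^2A=\nu_1A$ and $\mathrm{ad}_{JZ}^2A=\nu_2A$. Then $\nu_1,\nu_2\ge0$, and $A$ is an eigenvector of $E_Z,\ E_{JZ},\ S_Z,\ S_{JZ}$ with eigenvalues $$\frac{\sinh\sqrt{\nu_1}}{\sqrt{\nu_1}},\quad \frac{\sinh\sqrt{\nu_2}}{\sqrt{\nu_2}},\quad \cosh\sqrt{\nu_1},\quad \cosh\sqrt{\nu_2}$$ respectively, while $JA$ is an eigenvector of $E_Z,\ E_{JZ},\ S_Z,\ S_{JZ}$ with eigenvalues $$\frac{\sinh\sqrt{\nu_2}}{\sqrt{\nu_2}},\quad \frac{\sinh\sqrt{\nu_1}}{\sqrt{\nu_1}},\quad \cosh\sqrt{\nu_2},\quad \cosh\sqrt{\nu_1}$$ respectively. Here $\frac{\sinh\sqrt\nu}{\sqrt\nu}$ is read as $1$ for $\nu=0$. (2) Let $\mathfrak t$ be a $\theta$-stable Cartan subalgebra of $\mathfrak k$, let $\Psi$ be a maximal set of strongly orthogonal roots of $(\mathfrak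 g,\mathfrak t)$ with root spaces in $\mathfrak m^+$ (for distinct $\psi,\varphi\in\Psi$ neither $\psi+\varphi$ nor $\psi-\varphi$ is a root), and for $\psi\in\Psi$ let $e_\psi$ be a root vector such that $h_\psi=[e_\psi,\sigma e_\psi]$, $e_\psi$, $f_\psi=\sigma e_\psi$ form a standard $\mathfrak{sl}_2$-triple; put $x_\psi=e_\psi+f_\psi$ and $\mathfrak t^-=\sum_{\psi\in\Psi}\mathbb C h_\psi$. For a linear form $\alpha$ on $\mathfrak t^-$ put $\mathfrak m^+_\alpha=\{X\in\mathfrak m^+:[H,X]=\alpha(H)X\ \text{for all } H\in\mathfrak t^-\}$; the positive restricted $\mathfrak m$-roots are the $\alpha\neq0$ with $\mathfrak m^+_\alpha\neq0$. Let $Z=\sum_{\psi\in\Psi}\lambda_\psi x_\psi$ with $\lambda_\psi\in\mathbb R$, and let $\nu_1,\nu_2\in\mathbb R$. Let $(\mathfrak m_0)_{\{\nu_1,\nu_2\}}$ be the sum of the two real subspaces $\{A\in\mathfrak m_0:\mathrm{ad}_Z^2A=\nu_1A,\ \mathrm{ad}_{JZ}^2A=\nu_2A\}$ and $\{A\in\mathfrak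 m_0:\mathrm{ad}_Z^2A=\nu_2A,\ \mathrm{ad}_{JZ}^2A=\nu_1A\}$, and let $$\mathfrak m^+_{\{\nu_1,\nu_2\}}=\{A^+\in\mathfrak m^+: A^++\sigma A^+\in(\mathfrak m_0)_{\{\nu_1,\nu_2\}}\}.$$ Then $\mathfrak m^+_{\{\nu_1,\nu_2\}}$ is the direct sum of the restricted root spaces $\mathfrak m^+_\alpha$, where $\alpha$ runs over the positive restricted $\mathfrak m$-roots satisfying $$\alpha\Big(\sum_{\psi}\lambda_\psi^2h_\psi\Big)=\frac{\nu_1+\nu_2}2\qquad\text{and}\qquad \alpha\Big(\sum_\psi\lambda_\psi^4h_\psi\Big)=\frac{\nu_1^2+6\nu_1\nu_2+\nu_2^2}8.$$ -/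

import Mathlib

noncomputable section

namespace HermSym

/-- The infinitesimal data of an irreducible Hermitian symmetric space of compact type `G_u / K_0`
inside a complex simple Lie algebra `𝔤` (simplicity is a type class assumption where it is used):
commuting conjugate-linear involutive automorphisms `σ` and `θ`, where the real form fixed by `θ` is
compact, and an element `Υ` of the centre of `𝔨₀` with `ad Υ` squaring to `-1` on `𝔪`, i.e. acting
on `𝔪` with eigenvalues `± i`. -/
structure HermitianData (𝔤 : Type*) [LieRing 𝔤] [LieAlgebra ℂ 𝔤] where
  σ : 𝔤 →ₛₗ[starRingEnd ℂ] 𝔤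
  θ : 𝔤 →ₛₗ[starRingEnd ℂ] 𝔤
  σ_lie : ∀ X Y : 𝔤, σ ⁅X, Y⁆ = ⁅σ X, σ Y⁆
  θ_lie : ∀ X Y : 𝔤, θ ⁅X, Y⁆ = ⁅θ X, θ Y⁆
  σ_invol : ∀ X : 𝔤, σ (σ X) = X
  θ_invol : ∀ X : 𝔤, θ (θ X) = X
  comm : ∀ X : 𝔤, σ (θ X) = θ (σ X)
  /-- The Killing form is negative definite on `𝔤_u`, the fixed points of `θ`. -/
  compact : ∀ X : 𝔤, θ X = X → X ≠ 0 → (killingForm ℂ 𝔤 X X).re < 0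
  /-- The symmetric space is not a point: `𝔪 ≠ 0`. -/
  m_ne : ∃ X : 𝔤, σ (θ X) = -X ∧ X ≠ 0
  Υ : 𝔤
  σ_Υ : σ Υ = Υ
  θ_Υ : θ Υ = Υ
  Υ_central : ∀ X : 𝔤, σ X = X → θ X = X → ⁅Υ, X⁆ = 0
  Υ_sq : ∀ X : 𝔤, σ (θ X) = -X → ⁅Υ, ⁅Υ, X⁆⁆ = -X

section Operators

variable {𝔤 : Type*} [LieRing 𝔤] [LieAlgebra ℂ 𝔤]

/-- `Ad_{exp Z} = exp (ad Z) = ∑ (ad Z)^n / n!`, summed in the canonical (module) topology of the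
space `End 𝔤`, which is finite-dimensional when `𝔤` is. -/
def AdExp (Z : 𝔤) : Module.End ℂ 𝔤 :=
  letI : TopologicalSpace (Module.End ℂ 𝔤) := moduleTopology ℂ (Module.End ℂ 𝔤)
  ∑' n : ℕ, ((n.factorial : ℂ)⁻¹) • (LieAlgebra.ad ℂ 𝔤 Z) ^ n

/-- `E_Z = ∑ (ad Z)^{2n} / (2n+1)!`. -/
def E (Z : 𝔤) : Module.End ℂ 𝔤 :=
  letI : TopologicalSpace (Module.End ℂ 𝔤) := moduleTopology ℂ (Module.End ℂ 𝔤)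
  ∑' n : ℕ, (((2 * n + 1).factorial : ℂ)⁻¹) • (LieAlgebra.ad ℂ 𝔤 Z) ^ (2 * n)

/-- `S_Z = (Ad_{exp Z} + Ad_{exp Z}⁻¹) / 2`, where `(exp Z)⁻¹ = exp (-Z)`. -/
def S (Z : 𝔤) : Module.End ℂ 𝔤 :=
  (2⁻¹ : ℂ) • (AdExp Z + AdExp (-Z))

/-- `sinh √ν / √ν`, with its limit value `1` at `ν = 0`. -/
def sinhc (ν : ℝ) : ℝ :=
  if ν = 0 then 1 else Real.sinh (Real.sqrt ν) / Real.sqrt ν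

end Operators

namespace HermitianData

variable {𝔤 : Type*} [LieRing 𝔤] [LieAlgebra ℂ 𝔤] (D : HermitianData 𝔤)

/-- `J = ad Υ`. -/
def J (X : 𝔤) : 𝔤 := ⁅D.Υ, X⁆

/-- `𝔨`, the fixed points of the complex-linear involution `σθ`. -/
def k : LieSubalgebra ℂ 𝔤 where
  carrier := {X | D.σ (D.θ X) = X}
  add_mem' := by
    intro a b ha hb
    simp only [Set.mem_ofPred_eq] at *
    rw [map_add, map_add, ha, hb]
  zero_mem' := by simp
  smul_mem' := by
    intro c x hx
    simp only [Set.mem_ofPred_eq] at *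
    rw [map_smulₛₗ, map_smulₛₗ, hx]
    simp
  lie_mem' := by
    intro a b ha hb
    have ha' : D.σ (D.θ a) = a := ha
    have hb' : D.σ (D.θ b) = b := hb
    change D.σ (D.θ ⁅a, b⁆) = ⁅a, b⁆
    rw [D.θ_lie, D.σ_lie, ha', hb']

/-- `𝔪₀`: the vectors fixed by `σ` and negated by `θ`. -/
def m₀ : Submodule ℝ 𝔤 where
  carrier := {X | D.σ X = X ∧ D.θ X = -X}
  add_mem' := by
    rintro a b ⟨ha, ha'⟩ ⟨hb, hb'⟩
    refine ⟨by rw [map_add, ha, hb], by rw [map_add, ha', hb']; abel⟩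
  zero_mem' := by simp
  smul_mem' := by
    rintro c x ⟨hx, hx'⟩
    have e : c • x = (c : ℂ) • x := (Complex.coe_smul c x).symm
    refine ⟨?_, ?_⟩
    · rw [e, map_smulₛₗ, hx]; simp
    · rw [e, map_smulₛₗ, hx']; simp

/-- `𝔪⁺`: the `i`-eigenspace of `J` on `𝔪`, the `-1`-eigenspace of `σθ`. -/
def mPlus : Submodule ℂ 𝔤 where
  carrier := {X | D.σ (D.θ X) = -X ∧ D.J X = Complex.I • X}
  add_mem' := by
    rintro a b ⟨ha, ha'⟩ ⟨hb, hb'⟩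
    refine ⟨by rw [map_add, map_add, ha, hb]; abel, ?_⟩
    simp only [J] at *
    rw [lie_add, ha', hb', smul_add]
  zero_mem' := by simp [J]
  smul_mem' := by
    rintro c x ⟨hx, hx'⟩
    refine ⟨by rw [map_smulₛₗ, map_smulₛₗ, hx]; simp, ?_⟩
    simp only [J] at *
    rw [lie_smul, hx', smul_comm]

/-- The vectors `A ∈ 𝔪₀` with `ad_Z² A = ν A` and `ad_{JZ}² A = μ A`. -/
def orderedEigenspace (Z : 𝔤) (ν μ : ℝ) : Submodule ℝ 𝔤 where
  carrier := {A | A ∈ D.m₀ ∧ ⁅Z, ⁅Z, A⁆⁆ = ν • A ∧ ⁅D.J Z, ⁅D.J Z, A⁆⁆ = μ • A}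
  add_mem' := by
    rintro a b ⟨ha, ha₁, ha₂⟩ ⟨hb, hb₁, hb₂⟩
    refine ⟨D.m₀.add_mem ha hb, ?_, ?_⟩
    · rw [lie_add, lie_add, ha₁, hb₁, smul_add]
    · rw [lie_add, lie_add, ha₂, hb₂, smul_add]
  zero_mem' := ⟨D.m₀.zero_mem, by simp, by simp⟩
  smul_mem' := by
    rintro c x ⟨hx, hx₁, hx₂⟩
    have e : ∀ y : 𝔤, c • y = (c : ℂ) • y := fun y => (Complex.coe_smul c y).symm
    refine ⟨D.m₀.smul_mem c hx, ?_, ?_⟩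
    · rw [e, lie_smul, lie_smul, hx₁, ← e, ← e, smul_comm]
    · rw [e, lie_smul, lie_smul, hx₂, ← e, ← e, smul_comm]

/-- `(𝔪₀)_{ν₁,ν₂}`: the sum of the two ordered joint eigenspaces (they are independent when
`ν₁ ≠ ν₂`, and the same space when `ν₁ = ν₂`). -/
def m₀Joint (Z : 𝔤) (ν₁ ν₂ : ℝ) : Submodule ℝ 𝔤 :=
  D.orderedEigenspace Z ν₁ ν₂ ⊔ D.orderedEigenspace Z ν₂ ν₁

/-- `𝔪⁺_{ν₁,ν₂}`: the vectors `A⁺ ∈ 𝔪⁺` with `A⁺ + σ A⁺ ∈ (𝔪₀)_{ν₁,ν₂}`. -/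
def mPlusJoint (Z : 𝔤) (ν₁ ν₂ : ℝ) : Submodule ℝ 𝔤 where
  carrier := {A | A ∈ D.mPlus ∧ A + D.σ A ∈ D.m₀Joint Z ν₁ ν₂}
  add_mem' := by
    rintro a b ⟨ha, ha'⟩ ⟨hb, hb'⟩
    refine ⟨D.mPlus.add_mem ha hb, ?_⟩
    have e : a + b + D.σ (a + b) = (a + D.σ a) + (b + D.σ b) := by rw [map_add]; abel
    rw [e]
    exact Submodule.add_mem _ ha' hb'
  zero_mem' := ⟨D.mPlus.zero_mem, by simp⟩
  smul_mem' := by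
    rintro c x ⟨hx, hx'⟩
    have e : c • x = (c : ℂ) • x := (Complex.coe_smul c x).symm
    refine ⟨by rw [e]; exact D.mPlus.smul_mem _ hx, ?_⟩
    have e' : c • x + D.σ (c • x) = c • (x + D.σ x) := by
      rw [e, map_smulₛₗ, smul_add, e]; simp
    rw [e']
    exact Submodule.smul_mem _ c hx'

end HermitianData

section Roots

variable {𝔤 : Type*} [LieRing 𝔤] [LieAlgebra ℂ 𝔤]

/-- The joint eigenspace `{X | [H, X] = α(H) X for all H ∈ 𝔰}` of a subspace `𝔰` acting on `𝔤`. -/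
def weightSpace (𝔰 : Submodule ℂ 𝔤) (α : Module.Dual ℂ 𝔰) : Submodule ℂ 𝔤 where
  carrier := {X | ∀ H : 𝔰, ⁅(H : 𝔤), X⁆ = α H • X}
  add_mem' := by
    intro a b ha hb H
    rw [lie_add, ha H, hb H, smul_add]
  zero_mem' := by intro H; simp
  smul_mem' := by
    intro c x hx H
    rw [lie_smul, hx H, smul_comm]

/-- Roots (restricted roots, if `𝔰` is not a Cartan subalgebra): nonzero weights of `𝔰` on `𝔤`. -/
def IsRoot (𝔰 : Submodule ℂ 𝔤) (α : Module.Dual ℂ 𝔰) : Prop :=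
  α ≠ 0 ∧ weightSpace 𝔰 α ≠ ⊥

/-- A set of `𝔪⁺`-roots relative to `𝔱`, any two distinct members of which are
strongly orthogonal: neither their sum nor their difference is a root. -/
def IsStronglyOrthogonal (D : HermitianData 𝔤) (𝔱 : Submodule ℂ 𝔤)
    (Ψ : Set (Module.Dual ℂ 𝔱)) : Prop :=
  (∀ ψ ∈ Ψ, IsRoot 𝔱 ψ ∧ weightSpace 𝔱 ψ ≤ D.mPlus) ∧
    ∀ ψ ∈ Ψ, ∀ φ ∈ Ψ, ψ ≠ φ → ¬ IsRoot 𝔱 (ψ + φ) ∧ ¬ IsRoot 𝔱 (ψ - φ)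

/-- The choices entering the description by restricted roots: a `θ`-stable Cartan subalgebra `𝔱` of
`𝔨`, a maximal set `Ψ` of strongly orthogonal `𝔪⁺`-roots, and for `ψ ∈ Ψ` a root vector `e_ψ` such
that `h_ψ = [e_ψ, σ e_ψ]`, `e_ψ`, `f_ψ = σ e_ψ` form an `sl₂`-triple. -/
structure RootChoice (D : HermitianData 𝔤) where
  t : LieSubalgebra ℂ 𝔤
  t_le : t ≤ D.k
  t_cartan : (t.comap D.k.incl).IsCartanSubalgebra
  t_stable : ∀ H ∈ t, D.θ H ∈ t
  Ψ : Finset (Module.Dual ℂ t.toSubmodule)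
  maximal : Maximal (IsStronglyOrthogonal D t.toSubmodule)
    (Ψ : Set (Module.Dual ℂ t.toSubmodule))
  e : Ψ → 𝔤
  e_mem : ∀ ψ : Ψ, e ψ ∈ weightSpace t.toSubmodule (ψ : Module.Dual ℂ t.toSubmodule)
  triple : ∀ ψ : Ψ, IsSl2Triple ⁅e ψ, D.σ (e ψ)⁆ (e ψ) (D.σ (e ψ))

namespace RootChoice

variable {D : HermitianData 𝔤} (R : RootChoice D)

def h (ψ : R.Ψ) : 𝔤 := ⁅R.e ψ, D.σ (R.e ψ)⁆

def x (ψ : R.Ψ) : 𝔤 := R.e ψ + D.σ (R.e ψ)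

/-- `𝔱⁻`, the complex span of the `h_ψ`. -/
def tMinus : Submodule ℂ 𝔤 := Submodule.span ℂ (Set.range R.h)

/-- `∑ c_ψ h_ψ`, as an element of `𝔱⁻`. -/
def hSum (c : R.Ψ → ℝ) : R.tMinus :=
  ∑ ψ : R.Ψ, (c ψ : ℂ) • ⟨R.h ψ, Submodule.subset_span ⟨ψ, rfl⟩⟩

/-- `Z = ∑ c_ψ x_ψ`. -/
def xSum (c : R.Ψ → ℝ) : 𝔤 := ∑ ψ : R.Ψ, c ψ • R.x ψ

/-- The restricted root space `𝔪⁺_α`. -/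
def mPlusRoot (α : Module.Dual ℂ R.tMinus) : Submodule ℂ 𝔤 :=
  weightSpace R.tMinus α ⊓ D.mPlus

/-- The positive restricted `𝔪`-roots: the restricted roots occurring in `𝔪⁺`. -/
def IsRestrictedMRoot (α : Module.Dual ℂ R.tMinus) : Prop :=
  IsRoot R.tMinus α ∧ R.mPlusRoot α ≠ ⊥

/-- The positive restricted `𝔪`-roots `α` with `α(∑ c_ψ² h_ψ) = (ν₁ + ν₂) / 2` and
`α(∑ c_ψ⁴ h_ψ) = (ν₁² + 6 ν₁ ν₂ + ν₂²) / 8`. -/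
def eigenRoots (c : R.Ψ → ℝ) (ν₁ ν₂ : ℝ) : Set (Module.Dual ℂ R.tMinus) :=
  {α | R.IsRestrictedMRoot α ∧
    α (R.hSum fun ψ => c ψ ^ 2) = (((ν₁ + ν₂) / 2 : ℝ) : ℂ) ∧
    α (R.hSum fun ψ => c ψ ^ 4) = (((ν₁ ^ 2 + 6 * ν₁ * ν₂ + ν₂ ^ 2) / 8 : ℝ) : ℂ)}

end RootChoice

end Roots

end HermSym

end

/-! For (1), all four operators are power series in `ad Z` or `ad (J Z)` whose odd terms are absent
or cancel, so an eigenvector of the square gives the stated scalars. The form `-κ(X, θY)` is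
positive definite and makes `ad Z` self-adjoint for `Z ∈ 𝔪₀`, so `ν₁, ν₂ ≥ 0`. Since `[𝔪₀, 𝔪₀]` is
killed by `J`, conjugating by `J` exchanges `ad_Z²` and `ad_{JZ}²` (`lie_lie_J`).

For (2), identify `𝔪⁺` with `𝔪₀` by `A ↦ A + σA` and write `Z = U + σU`, where `U = ∑ λ_ψ e_ψ`.
Because `𝔪⁺` is abelian, `ad_Z²` and `ad_{JZ}²` become `P + Q` and `P - Q`, with `P = ad [U, σU]`
complex linear and `Q A = [U, [U, σA]]` conjugate linear. They commute (`lie_quad`), and `Q² = 2P² +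
ad [U, [[U, σU], σU]]` (`quad_quad`). The two ordered eigenspaces are `P = s`, `Q = ±δ`, with `s`,
`δ` the half sum and half difference of `ν₁`, `ν₂`; their sum is `P = s`, `Q² = δ²`, a pair of
complex linear conditions (`mem_mPlusJoint_iff`). Strong orthogonality gives `[U, σU] = ∑ λ_ψ² h_ψ`
and `[U, [[U, σU], σU]] = -2 ∑ λ_ψ⁴ h_ψ`, so these are eigenvalue conditions for two elements of
`𝔱⁻`.

The `h_ψ` commute and are self-adjoint, so this joint eigenspace splits into restricted weight
spaces. Weight zero does not occur: by maximality of `Ψ`, `𝔱⁻` centralizes no nonzero vector of `𝔪⁺`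
(`eq_zero_of_forall_lie_h`). -/

noncomputable section

namespace HermSym

/-! ### Convergence and termwise evaluation of series of endomorphisms. -/

section Series

variable {V : Type*} [AddCommGroup V] [Module ℂ V] [FiniteDimensional ℂ V]

/-- A finite-dimensional space is Hausdorff in its canonical topology. -/
theorem t2Space_of_isModuleTopology [TopologicalSpace V] [IsModuleTopology ℂ V] : T2Space V := by
  let e := (Module.finBasis ℂ V).equivFun
  exact T2Space.of_injective_continuous e.injective
    (IsModuleTopology.continuous_of_linearMap e.toLinearMap)

/-- The exponential series of an endomorphism converges in the canonical topology. -/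
theorem summable_exp_end (T : Module.End ℂ V) :
    letI : TopologicalSpace (Module.End ℂ V) := moduleTopology ℂ (Module.End ℂ V)
    Summable (fun n : ℕ => ((n.factorial : ℂ)⁻¹) • T ^ n) ∧
    Summable (fun n : ℕ => (((2 * n + 1).factorial : ℂ)⁻¹) • T ^ (2 * n)) := by
  let _ : TopologicalSpace (Module.End ℂ V) := moduleTopology ℂ (Module.End ℂ V)
  have : IsModuleTopology ℂ (Module.End ℂ V) := ⟨rfl⟩
  have := IsModuleTopology.topologicalAddGroup ℂ (Module.End ℂ V)
  have := IsModuleTopology.toContinuousSMul ℂ (Module.End ℂ V)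
  let e := LinearMap.toMatrixAlgEquiv (Module.finBasis ℂ V)
  let _ : NormedRing (Matrix (Fin (Module.finrank ℂ V)) (Fin (Module.finrank ℂ V)) ℂ) :=
    Matrix.linftyOpNormedRing
  let _ : NormedAlgebra ℂ (Matrix (Fin (Module.finrank ℂ V)) (Fin (Module.finrank ℂ V)) ℂ) :=
    Matrix.linftyOpNormedAlgebra
  have hc : Continuous e.symm.toLinearMap := LinearMap.continuous_of_finiteDimensional _
  have h₁ := NormedSpace.norm_expSeries_summable' (𝕂 := ℂ) (e T)
  have h₂ : Summable fun n : ℕ => (((2 * n + 1).factorial : ℂ)⁻¹) • (e T) ^ (2 * n) := by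
    -- Compare with the even-indexed terms of the exponential series, using `(2n)! ≤ (2n+1)!`.
    refine Summable.of_norm_bounded
      (h₁.comp_injective (i := fun n : ℕ => 2 * n) (fun a b hab => by simpa using hab)) ?_
    intro n
    simp only [Function.comp_apply, norm_smul]
    gcongr
    simp only [norm_inv, Complex.norm_natCast]
    gcongr
    omega
  constructor
  · convert h₁.of_norm.map e.symm.toLinearMap hc using 2 with n
    simp
  · convert h₂.map e.symm.toLinearMap hc using 2 with n
    simp

/-- Series of endomorphisms may be evaluated term by term: if `f (i n)` acts on `A` by
`g n` and the other terms kill `A`, then `∑ f` acts on `A` by `∑ g`. -/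
theorem tsum_apply_eq_of_hasSum {f : ℕ → Module.End ℂ V} {A : V} {g : ℕ → ℂ} {s : ℂ}
    (hf : letI : TopologicalSpace (Module.End ℂ V) := moduleTopology ℂ (Module.End ℂ V)
      Summable f)
    (i : ℕ → ℕ) (hi : Function.Injective i) (hfg : ∀ n, f (i n) A = g n • A)
    (h0 : ∀ m, m ∉ Set.range i → f m A = 0) (hg : HasSum g s) :
    (letI : TopologicalSpace (Module.End ℂ V) := moduleTopology ℂ (Module.End ℂ V)
      ∑' n, f n) A = s • A := by
  let _ : TopologicalSpace (Module.End ℂ V) := moduleTopology ℂ (Module.End ℂ V)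
  have : IsModuleTopology ℂ (Module.End ℂ V) := ⟨rfl⟩
  let _ : TopologicalSpace V := moduleTopology ℂ V
  have : IsModuleTopology ℂ V := ⟨rfl⟩
  have := IsModuleTopology.topologicalAddGroup ℂ V
  have := IsModuleTopology.toContinuousSMul ℂ V
  have : T2Space V := t2Space_of_isModuleTopology
  have hc : Continuous (LinearMap.applyₗ (R := ℂ) (M₂ := V) A) :=
    IsModuleTopology.continuous_of_linearMap _
  have h₁ := hf.hasSum.map (LinearMap.applyₗ (R := ℂ) (M₂ := V) A) hc
  have h₂ : HasSum (fun n => f n A) (s • A) := by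
    refine (hi.hasSum_iff fun m hm => h0 m hm).1 ?_
    have := hg.smul_const A
    refine this.congr_fun ?_ |> fun h => h
    intro n
    exact hfg n
  exact h₁.unique h₂

end Series

theorem hasSum_cosh_sqrt {ν : ℝ} (hν : 0 ≤ ν) :
    HasSum (fun n : ℕ => (((2 * n).factorial : ℂ)⁻¹) * (ν : ℂ) ^ n)
      (Real.cosh (Real.sqrt ν) : ℂ) := by
  have h := Real.hasSum_cosh (Real.sqrt ν)
  rw [← Complex.hasSum_ofReal] at h
  convert h using 2 with n
  rw [pow_mul, Real.sq_sqrt hν]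
  push_cast
  rw [div_eq_inv_mul]

theorem hasSum_sinhc {ν : ℝ} (hν : 0 ≤ ν) :
    HasSum (fun n : ℕ => (((2 * n + 1).factorial : ℂ)⁻¹) * (ν : ℂ) ^ n) (sinhc ν : ℂ) := by
  rcases eq_or_lt_of_le hν with rfl | hpos
  · convert hasSum_single (f := fun n : ℕ => (((2 * n + 1).factorial : ℂ)⁻¹) * ((0 : ℝ) : ℂ) ^ n)
      0 ?_ using 1
    · simp [sinhc]
    · intro n hn
      simp [hn]
  · have h := (Real.hasSum_sinh (Real.sqrt ν)).div_const (Real.sqrt ν)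
    rw [← Complex.hasSum_ofReal] at h
    have hs : Real.sqrt ν ≠ 0 := (Real.sqrt_pos.2 hpos).ne'
    rw [sinhc, if_neg hpos.ne']
    convert h using 2 with n
    rw [pow_succ, pow_mul, Real.sq_sqrt hν]
    rw [show ν ^ n * √ν / ((2 * n + 1).factorial : ℝ) / √ν
      = ((2 * n + 1).factorial : ℝ)⁻¹ * ν ^ n by field_simp]
    push_cast
    rfl

/-! ### The operators `E` and `S` on eigenvectors of `(ad Z)²`. -/

section Operators

variable {𝔤 : Type*} [LieRing 𝔤] [LieAlgebra ℂ 𝔤]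

theorem ad_pow_two_mul_apply {Z A : 𝔤} {ν : ℂ} (h : ⁅Z, ⁅Z, A⁆⁆ = ν • A) (n : ℕ) :
    (LieAlgebra.ad ℂ 𝔤 Z ^ (2 * n)) A = ν ^ n • A := by
  induction n with
  | zero => simp
  | succ n ih =>
    rw [show 2 * (n + 1) = 2 * n + 2 by ring, pow_add, Module.End.mul_apply]
    simp only [pow_two, Module.End.mul_apply, LieAlgebra.ad_apply]
    rw [h, map_smul, ih, smul_smul, pow_succ']

variable [FiniteDimensional ℂ 𝔤]

theorem E_apply {Z A : 𝔤} {ν : ℝ} (hν : 0 ≤ ν) (h : ⁅Z, ⁅Z, A⁆⁆ = (ν : ℂ) • A) :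
    E Z A = (sinhc ν : ℂ) • A := by
  refine tsum_apply_eq_of_hasSum (summable_exp_end _).2 id Function.injective_id (fun n => ?_)
    (fun m hm => (hm ⟨m, rfl⟩).elim) (hasSum_sinhc hν)
  simp only [id, LinearMap.smul_apply]
  rw [ad_pow_two_mul_apply h, smul_smul]

theorem S_apply {Z A : 𝔤} {ν : ℝ} (hν : 0 ≤ ν) (h : ⁅Z, ⁅Z, A⁆⁆ = (ν : ℂ) • A) :
    S Z A = (Real.cosh (Real.sqrt ν) : ℂ) • A := by
  let _ : TopologicalSpace (Module.End ℂ 𝔤) := moduleTopology ℂ (Module.End ℂ 𝔤)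
  have : IsModuleTopology ℂ (Module.End ℂ 𝔤) := ⟨rfl⟩
  have := IsModuleTopology.topologicalAddGroup ℂ (Module.End ℂ 𝔤)
  have := IsModuleTopology.toContinuousSMul ℂ (Module.End ℂ 𝔤)
  have : T2Space (Module.End ℂ 𝔤) := t2Space_of_isModuleTopology
  have h₁ := (summable_exp_end (LieAlgebra.ad ℂ 𝔤 Z)).1
  have h₂ := (summable_exp_end (LieAlgebra.ad ℂ 𝔤 (-Z))).1
  have hS : S Z = ∑' n : ℕ, (2⁻¹ : ℂ) • (((n.factorial : ℂ)⁻¹) • (LieAlgebra.ad ℂ 𝔤 Z) ^ n +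
      ((n.factorial : ℂ)⁻¹) • (LieAlgebra.ad ℂ 𝔤 (-Z)) ^ n) := by
    rw [S, AdExp, AdExp]
    exact (((h₁.hasSum.add h₂.hasSum).const_smul (2⁻¹ : ℂ)).tsum_eq).symm
  rw [hS]
  refine tsum_apply_eq_of_hasSum ((h₁.add h₂).const_smul (2⁻¹ : ℂ)) (fun n => 2 * n)
    (fun a b hab => by simpa using hab) (fun n => ?_) (fun m hm => ?_) (hasSum_cosh_sqrt hν)
  · simp only [LinearMap.smul_apply, LinearMap.add_apply, map_neg, even_two_mul, Even.neg_pow]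
    rw [ad_pow_two_mul_apply h]
    module
  -- The odd powers of `ad Z` and `ad (-Z)` cancel.
  · have hodd : Odd m := by
      rw [← Nat.not_even_iff_odd]
      rintro ⟨k, hk⟩
      exact hm ⟨k, by simp [hk, two_mul]⟩
    simp [hodd.neg_pow]

end Operators

section Weights

variable {𝔤 : Type*} [LieRing 𝔤] [LieAlgebra ℂ 𝔤]

theorem lie_lie_of_eigen {H X Y : 𝔤} {a b : ℂ} (hX : ⁅H, X⁆ = a • X) (hY : ⁅H, Y⁆ = b • Y) :
    ⁅H, ⁅X, Y⁆⁆ = (a + b) • ⁅X, Y⁆ := by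
  rw [leibniz_lie, hX, hY, smul_lie, lie_smul, add_smul]

end Weights

/-! ### The positive form, the grading by `Υ`, and the eigenvalues in (1). -/

namespace HermitianData

variable {𝔤 : Type*} [LieRing 𝔤] [LieAlgebra ℂ 𝔤] (D : HermitianData 𝔤)

theorem σ_smul (c : ℂ) (X : 𝔤) : D.σ (c • X) = (starRingEnd ℂ c) • D.σ X := map_smulₛₗ _ _ _

theorem θ_smul (c : ℂ) (X : 𝔤) : D.θ (c • X) = (starRingEnd ℂ c) • D.θ X := map_smulₛₗ _ _ _

/-! ### The positive sesquilinear form -/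

/-- The form `-κ(X, θ Y)`, where `κ` is the Killing form. -/
def form (X Y : 𝔤) : ℂ := -killingForm ℂ 𝔤 X (D.θ Y)

theorem form_lie_left (W X Y : 𝔤) : D.form ⁅W, X⁆ Y = -D.form X ⁅D.θ W, Y⁆ := by
  simp only [form, D.θ_lie, D.θ_invol]
  rw [LieModule.traceForm_apply_lie_apply' ℂ 𝔤 𝔤]

theorem form_smul_left (c : ℂ) (X Y : 𝔤) : D.form (c • X) Y = c * D.form X Y := by
  simp [form]

theorem form_smul_right (c : ℂ) (X Y : 𝔤) :
    D.form X (c • Y) = starRingEnd ℂ c * D.form X Y := by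
  simp [form, D.θ_smul]

theorem form_neg_right (X Y : 𝔤) : D.form X (-Y) = -D.form X Y := by simp [form]

@[simp] theorem form_zero_right (X : 𝔤) : D.form X 0 = 0 := by simp [form]

/-- Split `X = U + iW` along the compact real form: the cross terms cancel by symmetry of `κ`,
leaving `-κ(U, U) - κ(W, W)`. -/
theorem re_form_self_pos {X : 𝔤} (hX : X ≠ 0) : 0 < (D.form X X).re := by
  obtain ⟨U, W, hU, hW, rfl⟩ : ∃ U W : 𝔤, D.θ U = U ∧ D.θ W = W ∧ X = U + Complex.I • W := by
    refine ⟨(2⁻¹ : ℂ) • (X + D.θ X), (-Complex.I * 2⁻¹) • (X - D.θ X), ?_, ?_, ?_⟩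
    · rw [D.θ_smul, map_add, D.θ_invol, add_comm X, map_inv₀, Complex.conj_ofNat]
    · rw [D.θ_smul, map_sub, D.θ_invol, ← neg_sub X, smul_neg, ← neg_smul, map_mul,
        map_neg, Complex.conj_I, map_inv₀, Complex.conj_ofNat, neg_neg, neg_mul]
    · rw [smul_smul, show Complex.I * (-Complex.I * 2⁻¹) = 2⁻¹ by
        rw [← mul_assoc, mul_neg, Complex.I_mul_I]; ring]
      module
  have key : D.form (U + Complex.I • W) (U + Complex.I • W)
      = -killingForm ℂ 𝔤 U U - killingForm ℂ 𝔤 W W := by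
    have hc : killingForm ℂ 𝔤 W U = killingForm ℂ 𝔤 U W := LieModule.traceForm_comm ℂ 𝔤 𝔤 W U
    simp only [form, map_add, D.θ_smul, hU, hW, LinearMap.add_apply, map_smul,
      LinearMap.smul_apply, hc, Complex.conj_I, smul_eq_mul]
    linear_combination (killingForm ℂ 𝔤 W W) * Complex.I_mul_I
  have nonpos : ∀ Y : 𝔤, D.θ Y = Y → (killingForm ℂ 𝔤 Y Y).re ≤ 0 := by
    intro Y hY
    rcases eq_or_ne Y 0 with rfl | h
    · simp
    · exact (D.compact Y hY h).le
  rw [key, Complex.sub_re, Complex.neg_re]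
  by_cases h : U = 0
  · have hW0 : W ≠ 0 := by
      rintro rfl
      simp [h] at hX
    linarith [nonpos U hU, D.compact W hW hW0]
  · linarith [nonpos W hW, D.compact U hU h]

theorem eq_zero_of_form_self {X : 𝔤} (h : D.form X X = 0) : X = 0 := by
  by_contra hX
  have := D.re_form_self_pos hX
  simp [h] at this

theorem re_form_self_nonneg (X : 𝔤) : 0 ≤ (D.form X X).re := by
  rcases eq_or_ne X 0 with rfl | h
  · simp
  · exact (D.re_form_self_pos h).le

/-! ### The action of `Υ` -/

/-- `X + σX` and `i(X - σX)` lie in `𝔨₀`, where centrality of `Υ` applies, and together they recover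
`X`. -/
theorem lie_Υ_of_mem_k {X : 𝔤} (hX : X ∈ D.k) : ⁅D.Υ, X⁆ = 0 := by
  have hX' : D.σ (D.θ X) = X := hX
  have hσ : D.θ X = D.σ X := by rw [← D.σ_invol (D.θ X), hX']
  have hσ' : D.θ (D.σ X) = X := by rw [← D.comm, hX']
  have h₁ : ⁅D.Υ, X + D.σ X⁆ = 0 := D.Υ_central _
    (by rw [map_add, D.σ_invol, add_comm]) (by rw [map_add, hσ, hσ', add_comm])
  have h₂ : ⁅D.Υ, Complex.I • (X - D.σ X)⁆ = 0 := D.Υ_central _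
    (by rw [D.σ_smul, map_sub, D.σ_invol, Complex.conj_I]; module)
    (by rw [D.θ_smul, map_sub, hσ, hσ', Complex.conj_I]; module)
  rw [lie_smul, smul_eq_zero_iff_right Complex.I_ne_zero, lie_sub] at h₂
  rw [lie_add] at h₁
  have : (2 : ℂ) • ⁅D.Υ, X⁆ = 0 := by
    rw [two_smul]
    calc _ = (⁅D.Υ, X⁆ + ⁅D.Υ, D.σ X⁆) + (⁅D.Υ, X⁆ - ⁅D.Υ, D.σ X⁆) := by abel
      _ = 0 := by rw [h₁, h₂, add_zero]
  simpa using this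

theorem exists_add_eq (X : 𝔤) : ∃ K M : 𝔤, K ∈ D.k ∧ D.σ (D.θ M) = -M ∧ X = K + M := by
  have h : D.σ (D.θ (D.σ (D.θ X))) = X := by rw [D.comm, D.σ_invol, D.θ_invol]
  refine ⟨(2⁻¹ : ℂ) • (X + D.σ (D.θ X)), (2⁻¹ : ℂ) • (X - D.σ (D.θ X)), ?_, ?_, by module⟩
  · change D.σ (D.θ _) = _
    rw [D.θ_smul, D.σ_smul, map_add, map_add, h, add_comm X]
    simp
  · rw [D.θ_smul, D.σ_smul, map_sub, map_sub, h, ← smul_neg, neg_sub]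
    simp

/-- Since `Υ` kills `𝔨`, an `i`-eigenvector has no `𝔨`-component. Membership in `𝔪⁺` thus reduces to
adding eigenvalues of `ad Υ`. -/
theorem mem_mPlus_iff {X : 𝔤} : X ∈ D.mPlus ↔ ⁅D.Υ, X⁆ = Complex.I • X := by
  refine ⟨fun h => h.2, fun h => ⟨?_, h⟩⟩
  obtain ⟨K, M, hK, hM, rfl⟩ := D.exists_add_eq X
  have h₂ : ⁅D.Υ, ⁅D.Υ, K + M⁆⁆ = -(K + M) := by
    rw [h, lie_smul, h, smul_smul, Complex.I_mul_I, neg_one_smul]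
  rw [lie_add, lie_add, D.lie_Υ_of_mem_k hK, lie_zero, zero_add, D.Υ_sq M hM] at h₂
  have hK0 : K = 0 := by simpa using h₂
  simpa [hK0] using hM

/-- `T = ad Υ` vanishes on `𝔨` and squares to `-1` on `𝔪`, so `T³ + T = 0` and its only possible
eigenvalues are `0` and `±i`. -/
theorem eq_zero_of_lie_Υ {X : 𝔤} {c : ℂ} (h : ⁅D.Υ, X⁆ = c • X) (hc : c ^ 3 + c ≠ 0) : X = 0 := by
  have hcube : ⁅D.Υ, ⁅D.Υ, ⁅D.Υ, X⁆⁆⁆ = -⁅D.Υ, X⁆ := by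
    obtain ⟨K, M, hK, hM, rfl⟩ := D.exists_add_eq X
    simp only [lie_add, D.lie_Υ_of_mem_k hK, D.Υ_sq M hM, lie_neg, zero_add]
  simp only [h, lie_smul, smul_smul] at hcube
  have : (c ^ 3 + c) • X = 0 := by
    rw [eq_neg_iff_add_eq_zero, ← add_smul] at hcube
    rw [← hcube]
    congr 1
    ring
  exact (smul_eq_zero.1 this).resolve_left hc

theorem eq_zero_of_lie_Υ_two {X : 𝔤} (h : ⁅D.Υ, X⁆ = (2 * Complex.I) • X) : X = 0 := by
  refine D.eq_zero_of_lie_Υ h ?_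
  intro h0
  have : Complex.I = 0 := by
    linear_combination (-1 / 6 : ℂ) * h0 + (8 / 6 * Complex.I) * Complex.I_sq
  exact Complex.I_ne_zero this

theorem eq_zero_of_lie_Υ_neg_two {X : 𝔤} (h : ⁅D.Υ, X⁆ = (-(2 * Complex.I)) • X) : X = 0 := by
  refine D.eq_zero_of_lie_Υ h ?_
  intro h0
  have : Complex.I = 0 := by
    linear_combination (1 / 6 : ℂ) * h0 + (8 / 6 * Complex.I) * Complex.I_sq
  exact Complex.I_ne_zero this

theorem lie_Υ_σ {X : 𝔤} (h : X ∈ D.mPlus) : ⁅D.Υ, D.σ X⁆ = (-Complex.I) • D.σ X := by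
  have := congrArg D.σ (D.mem_mPlus_iff.1 h)
  rwa [D.σ_lie, D.σ_Υ, D.σ_smul, Complex.conj_I] at this

theorem θ_eq_of_mem_mPlus {X : 𝔤} (h : X ∈ D.mPlus) : D.θ X = -D.σ X := by
  rw [← D.σ_invol (D.θ X), h.1, map_neg]

theorem θ_σ_of_mem_mPlus {X : 𝔤} (h : X ∈ D.mPlus) : D.θ (D.σ X) = -X := by
  rw [← D.comm, h.1]

theorem lie_eq_zero_of_mem_mPlus {X Y : 𝔤} (hX : X ∈ D.mPlus) (hY : Y ∈ D.mPlus) : ⁅X, Y⁆ = 0 := by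
  refine D.eq_zero_of_lie_Υ_two ?_
  rw [lie_lie_of_eigen (D.mem_mPlus_iff.1 hX) (D.mem_mPlus_iff.1 hY), two_mul]

theorem lie_σ_eq_zero_of_mem_mPlus {X Y : 𝔤} (hX : X ∈ D.mPlus) (hY : Y ∈ D.mPlus) :
    ⁅D.σ X, D.σ Y⁆ = 0 := by
  rw [← D.σ_lie, D.lie_eq_zero_of_mem_mPlus hX hY, map_zero]

theorem lie_lie_σ_mem_mPlus {X Y W : 𝔤} (hX : X ∈ D.mPlus) (hY : Y ∈ D.mPlus)
    (hW : W ∈ D.mPlus) : ⁅⁅X, D.σ Y⁆, W⁆ ∈ D.mPlus := by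
  have hd := lie_lie_of_eigen (D.mem_mPlus_iff.1 hX) (D.lie_Υ_σ hY)
  rw [D.mem_mPlus_iff, lie_lie_of_eigen hd (D.mem_mPlus_iff.1 hW)]
  congr 1
  ring

theorem lie_lie_lie_σ_mem_mPlus {X Y W : 𝔤} (hX : X ∈ D.mPlus) (hY : Y ∈ D.mPlus)
    (hW : W ∈ D.mPlus) : ⁅X, ⁅Y, D.σ W⁆⁆ ∈ D.mPlus := by
  have hd := lie_lie_of_eigen (D.mem_mPlus_iff.1 hY) (D.lie_Υ_σ hW)
  rw [D.mem_mPlus_iff, lie_lie_of_eigen (D.mem_mPlus_iff.1 hX) hd]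
  congr 1
  ring

/-! ### The vectors of `𝔪₀` -/

theorem J_mem_m₀ {X : 𝔤} (hX : X ∈ D.m₀) : D.J X ∈ D.m₀ :=
  ⟨by rw [J, D.σ_lie, D.σ_Υ, hX.1], by rw [J, D.θ_lie, D.θ_Υ, hX.2, lie_neg]⟩

theorem J_J_of_mem_m₀ {X : 𝔤} (hX : X ∈ D.m₀) : D.J (D.J X) = -X :=
  D.Υ_sq X (by rw [hX.2, map_neg, hX.1])

theorem J_lie_eq_zero {X Y : 𝔤} (hX : X ∈ D.m₀) (hY : Y ∈ D.m₀) : ⁅D.Υ, ⁅X, Y⁆⁆ = 0 :=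
  D.Υ_central _ (by rw [D.σ_lie, hX.1, hY.1]) (by rw [D.θ_lie, hX.2, hY.2, lie_neg, neg_lie, neg_neg])

/-- `J` interchanges the roles of `ad_Z²` and `ad_{JZ}²`. -/
theorem lie_lie_J {Z A : 𝔤} (hZ : Z ∈ D.m₀) (hA : A ∈ D.m₀) :
    ⁅Z, ⁅Z, D.J A⁆⁆ = D.J ⁅D.J Z, ⁅D.J Z, A⁆⁆ := by
  -- `J` is a derivation that kills `[Z, A] ∈ 𝔨₀`.
  have h₁ : ⁅D.J Z, A⁆ = -⁅Z, D.J A⁆ := by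
    have := D.J_lie_eq_zero hZ hA
    rw [leibniz_lie] at this
    exact eq_neg_of_add_eq_zero_left this
  have h₂ : ⁅D.J Z, ⁅Z, D.J A⁆⁆ = D.J ⁅Z, ⁅Z, D.J A⁆⁆ := by
    have := leibniz_lie D.Υ Z ⁅Z, D.J A⁆
    rw [D.J_lie_eq_zero hZ (D.J_mem_m₀ hA), lie_zero, add_zero] at this
    exact this.symm
  have h₃ : ⁅Z, ⁅Z, D.J A⁆⁆ ∈ D.m₀ := by
    have := D.J_mem_m₀ hA
    exact ⟨by rw [D.σ_lie, D.σ_lie, hZ.1, this.1],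
      by rw [D.θ_lie, D.θ_lie, hZ.2, this.2]; simp⟩
  rw [h₁, lie_neg, h₂]
  have := D.J_J_of_mem_m₀ h₃
  have e : D.J (-D.J ⁅Z, ⁅Z, D.J A⁆⁆) = -D.J (D.J ⁅Z, ⁅Z, D.J A⁆⁆) := lie_neg _ _
  rw [e, this, neg_neg]

/-- As `θZ = -Z`, `ad Z` is self-adjoint for `form`, whence `ν |A|² = |[Z, A]|²`. -/
theorem nonneg_of_lie_lie_eq {Z A : 𝔤} (hZ : Z ∈ D.m₀) (hA0 : A ≠ 0) {ν : ℝ}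
    (h : ⁅Z, ⁅Z, A⁆⁆ = (ν : ℂ) • A) : 0 ≤ ν := by
  have h₁ : D.form ⁅Z, ⁅Z, A⁆⁆ A = D.form ⁅Z, A⁆ ⁅Z, A⁆ := by
    rw [D.form_lie_left, hZ.2, neg_lie, D.form_neg_right, neg_neg]
  rw [h, D.form_smul_left] at h₁
  have h₂ := D.re_form_self_nonneg ⁅Z, A⁆
  rw [← h₁, Complex.re_ofReal_mul] at h₂
  exact nonneg_of_mul_nonneg_left h₂ (D.re_form_self_pos hA0)

end HermitianData

/-- The eigenvalues of `E` and `S` at `Z` and `J Z`. -/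
theorem hasEigenvector_E_S {𝔤 : Type*} [LieRing 𝔤] [LieAlgebra ℂ 𝔤] [FiniteDimensional ℂ 𝔤]
    (D : HermitianData 𝔤) {Z A : 𝔤} (hZ : Z ∈ D.m₀) (hA : A ∈ D.m₀) (hA0 : A ≠ 0) {ν₁ ν₂ : ℝ}
    (h₁ : ⁅Z, ⁅Z, A⁆⁆ = ν₁ • A) (h₂ : ⁅D.J Z, ⁅D.J Z, A⁆⁆ = ν₂ • A) :
    (0 ≤ ν₁ ∧ 0 ≤ ν₂) ∧
      ((E Z).HasEigenvector (sinhc ν₁ : ℂ) A ∧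
        (E (D.J Z)).HasEigenvector (sinhc ν₂ : ℂ) A ∧
        (S Z).HasEigenvector (Real.cosh (Real.sqrt ν₁) : ℂ) A ∧
        (S (D.J Z)).HasEigenvector (Real.cosh (Real.sqrt ν₂) : ℂ) A) ∧
      ((E Z).HasEigenvector (sinhc ν₂ : ℂ) (D.J A) ∧
        (E (D.J Z)).HasEigenvector (sinhc ν₁ : ℂ) (D.J A) ∧
        (S Z).HasEigenvector (Real.cosh (Real.sqrt ν₂) : ℂ) (D.J A) ∧
        (S (D.J Z)).HasEigenvector (Real.cosh (Real.sqrt ν₁) : ℂ) (D.J A)) := by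
  rw [← Complex.coe_smul] at h₁ h₂
  have hJA0 : D.J A ≠ 0 := by
    intro h
    have := D.J_J_of_mem_m₀ hA
    rw [h] at this
    exact hA0 (by simpa [HermitianData.J] using this.symm)
  have h₃ : ⁅Z, ⁅Z, D.J A⁆⁆ = (ν₂ : ℂ) • D.J A := by
    rw [D.lie_lie_J hZ hA, h₂, HermitianData.J, lie_smul, HermitianData.J]
  have h₄ : ⁅D.J Z, ⁅D.J Z, D.J A⁆⁆ = (ν₁ : ℂ) • D.J A := by
    rw [D.lie_lie_J (D.J_mem_m₀ hZ) hA, D.J_J_of_mem_m₀ hZ]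
    simp only [neg_lie, lie_neg, neg_neg, h₁]
    rw [HermitianData.J, lie_smul, HermitianData.J]
  have n₁ := D.nonneg_of_lie_lie_eq hZ hA0 h₁
  have n₂ := D.nonneg_of_lie_lie_eq (D.J_mem_m₀ hZ) hA0 h₂
  have ev : ∀ {f : Module.End ℂ 𝔤} {c : ℂ} {X : 𝔤}, X ≠ 0 → f X = c • X → f.HasEigenvector c X :=
    fun h0 h => ⟨Module.End.mem_eigenspace_iff.2 h, h0⟩
  exact ⟨⟨n₁, n₂⟩,
    ⟨ev hA0 (E_apply n₁ h₁), ev hA0 (E_apply n₂ h₂), ev hA0 (S_apply n₁ h₁),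
      ev hA0 (S_apply n₂ h₂)⟩,
    ⟨ev hJA0 (E_apply n₂ h₃), ev hJA0 (E_apply n₁ h₄), ev hJA0 (S_apply n₂ h₃),
      ev hJA0 (S_apply n₁ h₄)⟩⟩

/-! ### Transfer of the eigenvalue problem from `𝔪₀` to `𝔪⁺`. -/

namespace HermitianData

variable {𝔤 : Type*} [LieRing 𝔤] [LieAlgebra ℂ 𝔤] (D : HermitianData 𝔤)

theorem add_σ_mem_m₀ {A : 𝔤} (hA : A ∈ D.mPlus) : A + D.σ A ∈ D.m₀ :=
  ⟨by rw [map_add, D.σ_invol, add_comm],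
    by rw [map_add, D.θ_eq_of_mem_mPlus hA, D.θ_σ_of_mem_mPlus hA]; abel⟩

theorem exists_add_σ_eq {X : 𝔤} (hX : X ∈ D.m₀) : ∃ A ∈ D.mPlus, X = A + D.σ A := by
  have hJ : ⁅D.Υ, ⁅D.Υ, X⁆⁆ = -X := D.J_J_of_mem_m₀ hX
  have hσ : D.σ ⁅D.Υ, X⁆ = ⁅D.Υ, X⁆ := (D.J_mem_m₀ hX).1
  refine ⟨(2⁻¹ : ℂ) • (X - Complex.I • ⁅D.Υ, X⁆), ?_, ?_⟩
  · rw [D.mem_mPlus_iff, lie_smul, lie_sub, lie_smul, hJ, smul_comm]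
    congr 1
    rw [smul_sub, smul_smul, Complex.I_mul_I]
    module
  · rw [D.σ_smul, map_sub, D.σ_smul, hX.1, hσ, map_inv₀, Complex.conj_ofNat, Complex.conj_I]
    module

/-- Applying `ad Υ` to `A + σA` gives `i(A - σA)`, so the sum determines the difference as well. -/
theorem add_σ_injOn {A B : 𝔤} (hA : A ∈ D.mPlus) (hB : B ∈ D.mPlus)
    (h : A + D.σ A = B + D.σ B) : A = B := by
  have hs := congrArg (fun X => ⁅D.Υ, X⁆) h
  simp only [lie_add, D.mem_mPlus_iff.1 hA, D.mem_mPlus_iff.1 hB, D.lie_Υ_σ hA, D.lie_Υ_σ hB,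
    neg_smul, ← sub_eq_add_neg, ← smul_sub] at hs
  have hs' := smul_right_injective 𝔤 Complex.I_ne_zero hs
  have h2 : (2 : ℂ) • A = (2 : ℂ) • B := by
    calc (2 : ℂ) • A = (A + D.σ A) + (A - D.σ A) := by module
      _ = (B + D.σ B) + (B - D.σ B) := by rw [h, hs']
      _ = (2 : ℂ) • B := by module
  exact smul_right_injective 𝔤 two_ne_zero h2

/-- The conjugate-linear map `A ↦ [U, [U, σ A]]`, which maps `𝔪⁺` to itself when `U ∈ 𝔪⁺`. -/
def quad (U A : 𝔤) : 𝔤 := ⁅U, ⁅U, D.σ A⁆⁆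

theorem quad_smul (U A : 𝔤) (c : ℂ) : D.quad U (c • A) = starRingEnd ℂ c • D.quad U A := by
  simp only [quad, D.σ_smul, lie_smul]

theorem quad_real_smul (U A : 𝔤) (c : ℝ) : D.quad U ((c : ℂ) • A) = (c : ℂ) • D.quad U A := by
  rw [quad_smul, Complex.conj_ofReal]

theorem quad_add (U A B : 𝔤) : D.quad U (A + B) = D.quad U A + D.quad U B := by
  simp only [quad, map_add, lie_add]

theorem quad_mem_mPlus {U A : 𝔤} (hU : U ∈ D.mPlus) (hA : A ∈ D.mPlus) : D.quad U A ∈ D.mPlus :=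
  D.lie_lie_lie_σ_mem_mPlus hU hU hA

/-- Brackets within `𝔪⁺` and within `σ𝔪⁺` vanish; the surviving terms are `P A + Q A` and their
conjugates. For `J Z = i(U - σU)`, in the next lemma, only the sign of `Q` changes. -/
theorem lie_lie_real_apply {U A : 𝔤} (hU : U ∈ D.mPlus) (hA : A ∈ D.mPlus) :
    ⁅U + D.σ U, ⁅U + D.σ U, A + D.σ A⁆⁆ = (⁅⁅U, D.σ U⁆, A⁆ + D.quad U A) +
      D.σ (⁅⁅U, D.σ U⁆, A⁆ + D.quad U A) := by
  have h₁ := D.lie_eq_zero_of_mem_mPlus hU hA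
  have h₂ := D.lie_σ_eq_zero_of_mem_mPlus hU hA
  simp only [quad, map_add, D.σ_lie, D.σ_invol]
  simp only [lie_lie, add_lie, lie_add, h₁, h₂, lie_zero]
  abel

theorem lie_lie_J_real_apply {U A : 𝔤} (hU : U ∈ D.mPlus) (hA : A ∈ D.mPlus) :
    ⁅D.J (U + D.σ U), ⁅D.J (U + D.σ U), A + D.σ A⁆⁆ = (⁅⁅U, D.σ U⁆, A⁆ - D.quad U A) +
      D.σ (⁅⁅U, D.σ U⁆, A⁆ - D.quad U A) := by
  have h₁ := D.lie_eq_zero_of_mem_mPlus hU hA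
  have h₂ := D.lie_σ_eq_zero_of_mem_mPlus hU hA
  have hJ : D.J (U + D.σ U) = Complex.I • (U - D.σ U) := by
    rw [J, lie_add, D.mem_mPlus_iff.1 hU, D.lie_Υ_σ hU]
    module
  rw [hJ, smul_lie, smul_lie, lie_smul, smul_smul, Complex.I_mul_I, neg_one_smul]
  simp only [quad, map_sub, D.σ_lie, D.σ_invol]
  simp only [lie_lie, sub_lie, lie_sub, lie_add, h₁, h₂, lie_zero]
  abel

theorem add_σ_mem_orderedEigenspace {U A : 𝔤} (hU : U ∈ D.mPlus) (hA : A ∈ D.mPlus) {ν μ : ℝ} :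
    A + D.σ A ∈ D.orderedEigenspace (U + D.σ U) ν μ ↔
      ⁅⁅U, D.σ U⁆, A⁆ = (((ν + μ) / 2 : ℝ) : ℂ) • A ∧
        D.quad U A = (((ν - μ) / 2 : ℝ) : ℂ) • A := by
  have hP := D.lie_lie_σ_mem_mPlus hU hU hA
  have hQ := D.quad_mem_mPlus hU hA
  have hs : ∀ c : ℝ, c • (A + D.σ A) = (c : ℂ) • A + D.σ ((c : ℂ) • A) := by
    intro c
    rw [← Complex.coe_smul, D.σ_smul, Complex.conj_ofReal, smul_add]
  have key : A + D.σ A ∈ D.orderedEigenspace (U + D.σ U) ν μ ↔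
      ⁅⁅U, D.σ U⁆, A⁆ + D.quad U A = (ν : ℂ) • A ∧ ⁅⁅U, D.σ U⁆, A⁆ - D.quad U A = (μ : ℂ) • A := by
    constructor
    · rintro ⟨-, h₁, h₂⟩
      rw [D.lie_lie_real_apply hU hA, hs] at h₁
      rw [D.lie_lie_J_real_apply hU hA, hs] at h₂
      exact ⟨D.add_σ_injOn (add_mem hP hQ) (D.mPlus.smul_mem _ hA) h₁,
        D.add_σ_injOn (sub_mem hP hQ) (D.mPlus.smul_mem _ hA) h₂⟩
    · rintro ⟨h₁, h₂⟩
      exact ⟨D.add_σ_mem_m₀ hA, by rw [D.lie_lie_real_apply hU hA, hs, h₁],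
        by rw [D.lie_lie_J_real_apply hU hA, hs, h₂]⟩
  rw [key]
  push_cast
  constructor
  · rintro ⟨h₁, h₂⟩
    constructor
    · linear_combination (norm := module) (2⁻¹ : ℂ) • h₁ + (2⁻¹ : ℂ) • h₂
    · linear_combination (norm := module) (2⁻¹ : ℂ) • h₁ - (2⁻¹ : ℂ) • h₂
  · rintro ⟨h₁, h₂⟩
    rw [h₁, h₂]
    constructor <;> module

/-- The square of `quad U` on `𝔪⁺`. -/
theorem quad_quad {U A : 𝔤} (hU : U ∈ D.mPlus) (hA : A ∈ D.mPlus) :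
    D.quad U (D.quad U A) = (2 : ℂ) • ⁅⁅U, D.σ U⁆, ⁅⁅U, D.σ U⁆, A⁆⁆ +
      ⁅⁅U, ⁅⁅U, D.σ U⁆, D.σ U⁆⁆, A⁆ := by
  have h₁ := D.lie_eq_zero_of_mem_mPlus hU hA
  -- `[U, [σU, A]] = [[U, σU], A]` lies in the abelian space `𝔪⁺`, hence commutes with `U`.
  have h₂ : ⁅U, ⁅U, ⁅D.σ U, A⁆⁆⁆ = 0 := by
    have := D.lie_eq_zero_of_mem_mPlus hU (D.lie_lie_σ_mem_mPlus hU hU hA)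
    simpa only [lie_lie, h₁, lie_zero, sub_zero] using this
  simp only [quad, D.σ_lie, D.σ_invol]
  simp only [lie_lie, lie_sub, lie_self, lie_neg, neg_lie, zero_sub, h₁, h₂, lie_zero]
  module

/-- The map `quad U` commutes with `ad [U, σ U]` on `𝔪⁺`. -/
theorem lie_quad {U A : 𝔤} (hU : U ∈ D.mPlus) (hA : A ∈ D.mPlus) :
    ⁅⁅U, D.σ U⁆, D.quad U A⁆ = D.quad U ⁅⁅U, D.σ U⁆, A⁆ := by
  have h₁ := D.lie_σ_eq_zero_of_mem_mPlus hU hA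
  have h₂ : ⁅U, ⁅U, ⁅U, D.σ A⁆⁆⁆ = 0 :=
    D.lie_eq_zero_of_mem_mPlus hU (D.quad_mem_mPlus hU hA)
  -- The inner bracket is of two elements of `𝔪⁺`. Expanded by Jacobi, this vanishing expression is
  -- `-3` times the difference of the two sides of the goal.
  have h₃ : ⁅⁅U, ⁅⁅U, D.σ U⁆, U⁆⁆, D.σ A⁆ = 0 := by
    rw [D.lie_eq_zero_of_mem_mPlus hU (D.lie_lie_σ_mem_mPlus hU hU hU), zero_lie]
  simp only [lie_lie, lie_sub, sub_lie, h₁, h₂, lie_zero] at h₃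
  simp only [quad, D.σ_lie, D.σ_invol]
  simp only [lie_lie, lie_sub, h₁, h₂, lie_zero]
  linear_combination (norm := module) (-3⁻¹ : ℂ) • h₃

/-- Moving `ad U` twice across the form gives `|QA|² = form (σA) (σ(Q²A))`. -/
theorem quad_eq_zero_of_quad_quad {U A : 𝔤} (hU : U ∈ D.mPlus)
    (h : D.quad U (D.quad U A) = 0) : D.quad U A = 0 := by
  have h' : ⁅D.σ U, ⁅D.σ U, D.quad U A⁆⁆ = 0 := by
    have := congrArg D.σ h
    rw [map_zero] at this
    rwa [quad, D.σ_lie, D.σ_lie, D.σ_invol] at this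
  refine D.eq_zero_of_form_self ?_
  rw [quad, D.form_lie_left, D.form_lie_left, D.θ_eq_of_mem_mPlus hU]
  rw [neg_lie, neg_lie, lie_neg, neg_neg, D.form_neg_right, D.form_neg_right, neg_neg]
  change D.form (D.σ A) ⁅D.σ U, ⁅D.σ U, D.quad U A⁆⁆ = 0
  rw [h', form_zero_right]

/-- Description of `𝔪⁺_{ν₁,ν₂}` by two linear equations. -/
theorem mem_mPlusJoint_iff {U A : 𝔤} (hU : U ∈ D.mPlus) {ν₁ ν₂ : ℝ} :
    A ∈ D.mPlusJoint (U + D.σ U) ν₁ ν₂ ↔ A ∈ D.mPlus ∧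
      ⁅⁅U, D.σ U⁆, A⁆ = (((ν₁ + ν₂) / 2 : ℝ) : ℂ) • A ∧
      ⁅⁅U, ⁅⁅U, D.σ U⁆, D.σ U⁆⁆, A⁆ =
        (((-2) * ((ν₁ ^ 2 + 6 * ν₁ * ν₂ + ν₂ ^ 2) / 8) : ℝ) : ℂ) • A := by
  set s : ℝ := (ν₁ + ν₂) / 2 with hs
  set δ : ℝ := (ν₁ - ν₂) / 2 with hδ
  -- Where `P = s`, `quad_quad` says that the triple bracket acts as `Q² - 2s²`; the constant in the
  -- statement encodes `Q² = δ²`.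
  have hr : ((-2) * ((ν₁ ^ 2 + 6 * ν₁ * ν₂ + ν₂ ^ 2) / 8) : ℝ) = δ ^ 2 - 2 * s ^ 2 := by
    rw [hs, hδ]; ring
  have hs' : (ν₂ + ν₁) / 2 = s := by rw [hs]; ring
  have hδ' : (ν₂ - ν₁) / 2 = -δ := by rw [hδ]; ring
  rw [hr]
  constructor
  · rintro ⟨hA, hAj⟩
    obtain ⟨X, hX, Y, hY, hXY⟩ := Submodule.mem_sup.1 hAj
    obtain ⟨B, hB, rfl⟩ := D.exists_add_σ_eq hX.1
    obtain ⟨C, hC, rfl⟩ := D.exists_add_σ_eq hY.1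
    obtain ⟨hB₁, hB₂⟩ := (D.add_σ_mem_orderedEigenspace hU hB).1 hX
    obtain ⟨hC₁, hC₂⟩ := (D.add_σ_mem_orderedEigenspace hU hC).1 hY
    rw [← hs] at hB₁
    rw [← hδ] at hB₂
    rw [hs'] at hC₁
    rw [hδ'] at hC₂
    obtain rfl : A = B + C := D.add_σ_injOn hA (add_mem hB hC) (by rw [← hXY, map_add]; abel)
    have h₁ : ⁅⁅U, D.σ U⁆, B + C⁆ = (s : ℂ) • (B + C) := by rw [lie_add, hB₁, hC₁, smul_add]
    refine ⟨hA, h₁, ?_⟩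
    have h₂ := D.quad_quad hU hA
    rw [h₁, lie_smul, h₁, D.quad_add, D.quad_add, hB₂, hC₂, quad_real_smul, quad_real_smul,
      hB₂, hC₂] at h₂
    rw [← sub_eq_iff_eq_add'] at h₂
    rw [← h₂]
    push_cast
    module
  · rintro ⟨hA, h₁, h₂⟩
    have h₃ := D.quad_quad hU hA
    rw [h₁, lie_smul, h₁, h₂] at h₃
    have h₄ : D.quad U (D.quad U A) = (δ : ℂ) • (δ : ℂ) • A := by
      rw [h₃]
      push_cast
      module
    refine ⟨hA, ?_⟩
    -- For `δ = 0` there are no two eigenspaces to project to, and `Q² = 0` must force `Q = 0`,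
    -- which is where positivity enters.
    by_cases h0 : δ = 0
    · refine Submodule.mem_sup_left ((D.add_σ_mem_orderedEigenspace hU hA).2 ⟨h₁, ?_⟩)
      rw [← hδ, h0, Complex.ofReal_zero, zero_smul]
      refine D.quad_eq_zero_of_quad_quad hU ?_
      rw [h₄, h0, Complex.ofReal_zero, zero_smul]
    · have hQ := D.quad_mem_mPlus hU hA
      have hδC : (δ : ℂ) ≠ 0 := by exact_mod_cast h0
      have hHQ : ⁅⁅U, D.σ U⁆, D.quad U A⁆ = (s : ℂ) • D.quad U A := by
        rw [D.lie_quad hU hA, h₁, quad_real_smul]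
      -- `½(A + εδ⁻¹QA)` is the projection of `A` to `Q = εδ`. The coefficients are real, so
      -- conjugate linearity of `Q` does no harm.
      have part : ∀ ε : ℝ, ε * ε = 1 → ∀ ν μ : ℝ, (ν + μ) / 2 = s → (ν - μ) / 2 = ε * δ →
          ((2⁻¹ : ℝ) : ℂ) • (A + ((ε * δ⁻¹ : ℝ) : ℂ) • D.quad U A) +
            D.σ (((2⁻¹ : ℝ) : ℂ) • (A + ((ε * δ⁻¹ : ℝ) : ℂ) • D.quad U A)) ∈
            D.orderedEigenspace (U + D.σ U) ν μ := by
        intro ε hε ν μ h₅ h₆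
        refine (D.add_σ_mem_orderedEigenspace hU (D.mPlus.smul_mem _
          (add_mem hA (D.mPlus.smul_mem _ hQ)))).2 ⟨?_, ?_⟩
        · rw [h₅, lie_smul, lie_add, lie_smul, h₁, hHQ]
          module
        · rw [h₆, quad_real_smul, quad_add, quad_real_smul, h₄]
          have e₁ : ((ε * δ⁻¹ : ℝ) : ℂ) * (δ * δ) = ((ε * δ : ℝ) : ℂ) := by
            push_cast
            field_simp
          have e₂ : ((ε * δ : ℝ) : ℂ) * ((ε * δ⁻¹ : ℝ) : ℂ) = 1 := by
            rw [← Complex.ofReal_mul, show ε * δ * (ε * δ⁻¹) = ε * ε * (δ * δ⁻¹) by ring, hε,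
              mul_inv_cancel₀ h0]
            simp
          rw [smul_smul (δ : ℂ), smul_smul, e₁, smul_comm (((ε * δ : ℝ) : ℂ)), smul_add (((ε * δ : ℝ) : ℂ)),
            smul_smul (((ε * δ : ℝ) : ℂ)) (((ε * δ⁻¹ : ℝ) : ℂ)), e₂, one_smul, add_comm]
      have e : A + D.σ A = (((2⁻¹ : ℝ) : ℂ) • (A + ((1 * δ⁻¹ : ℝ) : ℂ) • D.quad U A) +
            D.σ (((2⁻¹ : ℝ) : ℂ) • (A + ((1 * δ⁻¹ : ℝ) : ℂ) • D.quad U A))) +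
          (((2⁻¹ : ℝ) : ℂ) • (A + ((-1 * δ⁻¹ : ℝ) : ℂ) • D.quad U A) +
            D.σ (((2⁻¹ : ℝ) : ℂ) • (A + ((-1 * δ⁻¹ : ℝ) : ℂ) • D.quad U A))) := by
        simp only [D.σ_smul, map_add, Complex.conj_ofReal]
        push_cast
        module
      rw [e]
      exact add_mem (Submodule.mem_sup_left (part 1 (by norm_num) _ _ hs.symm (by rw [one_mul])))
        (Submodule.mem_sup_right (part (-1) (by norm_num) _ _ hs' (by rw [hδ', neg_one_mul])))

variable {𝔤 : Type*} [LieRing 𝔤] [LieAlgebra ℂ 𝔤] (D : HermitianData 𝔤)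

/-- In the `sl₂`-triple spanned by `e ∈ 𝔪⁺` and `σ e`, lowering twice is injective on the weight
space of weight `2`. -/
theorem eq_zero_of_lower_twice {e X : 𝔤} (he : e ∈ D.mPlus)
    (ht : IsSl2Triple ⁅e, D.σ e⁆ e (D.σ e)) (hX : ⁅⁅e, D.σ e⁆, X⁆ = (2 : ℂ) • X)
    (hff : ⁅D.σ e, ⁅D.σ e, X⁆⁆ = 0) : X = 0 := by
  have form_e : ∀ Y Z : 𝔤, D.form ⁅e, Y⁆ Z = D.form Y ⁅D.σ e, Z⁆ := by
    intro Y Z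
    rw [D.form_lie_left, D.θ_eq_of_mem_mPlus he, neg_lie, D.form_neg_right, neg_neg]
  have form_f : ∀ Y Z : 𝔤, D.form ⁅D.σ e, Y⁆ Z = D.form Y ⁅e, Z⁆ := by
    intro Y Z
    rw [D.form_lie_left, D.θ_σ_of_mem_mPlus he, neg_lie, D.form_neg_right, neg_neg]
  have fe : ∀ Y : 𝔤, ⁅D.σ e, ⁅e, Y⁆⁆ = ⁅e, ⁅D.σ e, Y⁆⁆ - ⁅⁅e, D.σ e⁆, Y⁆ := by
    intro Y
    rw [lie_lie]
    abel
  have hf : ⁅⁅e, D.σ e⁆, D.σ e⁆ = (-2 : ℂ) • D.σ e := by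
    rw [ht.lie_h_f_nsmul]
    module
  -- With `f = σe`, one has `|eY|² = form Y (efY - hY)`. For `Y = fX`, of weight `0` and killed by
  -- `f`, this gives `efX = 0`, hence `|fX|² = form X (efX) = 0`. For `Y = X` it then gives `|eX|² =
  -- -2|X|²`.
  have hw : ⁅⁅e, D.σ e⁆, ⁅D.σ e, X⁆⁆ = 0 := by
    rw [lie_lie_of_eigen hf hX]
    simp
  have ew : ⁅e, ⁅D.σ e, X⁆⁆ = 0 := by
    refine D.eq_zero_of_form_self ?_
    rw [form_e, fe, hff, hw]
    simp
  have w0 : ⁅D.σ e, X⁆ = 0 := by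
    refine D.eq_zero_of_form_self ?_
    rw [form_f, ew, D.form_zero_right]
  have hpos := D.re_form_self_nonneg ⁅e, X⁆
  rw [form_e, fe, w0, lie_zero, hX, zero_sub, D.form_neg_right, D.form_smul_right] at hpos
  by_contra h0
  have := D.re_form_self_pos h0
  rw [Complex.conj_ofNat, Complex.neg_re, Complex.mul_re, Complex.re_ofNat,
    Complex.im_ofNat, zero_mul, sub_zero] at hpos
  linarith

end HermitianData

/-! ### The Cartan subalgebra `𝔱` and the maximality of `Ψ`. -/

namespace RootChoice

variable {𝔤 : Type*} [LieRing 𝔤] [LieAlgebra ℂ 𝔤] {D : HermitianData 𝔤} (R : RootChoice D)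

/-- The Killing form of `𝔤` is nondegenerate on `𝔱`, because `θX ∈ 𝔱` pairs nontrivially with `X ≠
0`; a nilpotent Lie algebra with a nondegenerate trace form is abelian. -/
theorem lie_eq_zero_of_mem_t [FiniteDimensional ℂ 𝔤] {H H' : 𝔤} (hH : H ∈ R.t) (hH' : H' ∈ R.t) :
    ⁅H, H'⁆ = 0 := by
  have := R.t_cartan
  have hab : IsLieAbelian (R.t.comap D.k.incl) := by
    refine LieModule.isLieAbelian_of_ker_traceForm_eq_bot ℂ _ 𝔤 ?_
    rw [LinearMap.ker_eq_bot']
    rintro ⟨⟨X, hXk⟩, hX⟩ h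
    have hXt : X ∈ R.t := hX
    have hθ := R.t_stable X hXt
    have h' := LinearMap.congr_fun h ⟨⟨D.θ X, R.t_le hθ⟩, hθ⟩
    have h0 : D.form X X = 0 := neg_eq_zero.2 h'
    have := D.eq_zero_of_form_self h0
    subst this
    rfl
  have h := hab.trivial ⟨⟨H, R.t_le hH⟩, hH⟩ ⟨⟨H', R.t_le hH'⟩, hH'⟩
  exact congrArg (fun x : R.t.comap D.k.incl => ((x : D.k) : 𝔤)) h

/-- A Cartan subalgebra is self-normalizing. This places `Υ` and every `h_ψ` in `𝔱`. -/
theorem mem_t_of_centralizes {X : 𝔤} (hX : X ∈ D.k) (h : ∀ H ∈ R.t, ⁅H, X⁆ = 0) : X ∈ R.t := by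
  have hn : (⟨X, hX⟩ : D.k) ∈ (R.t.comap D.k.incl).normalizer := by
    rw [LieSubalgebra.mem_normalizer_iff']
    intro y hy
    have : ⁅y, (⟨X, hX⟩ : D.k)⁆ = 0 := Subtype.ext (h _ hy)
    rw [this]
    exact zero_mem _
  rw [R.t_cartan.self_normalizing] at hn
  exact hn

theorem Υ_mem_t : D.Υ ∈ R.t := by
  refine R.mem_t_of_centralizes ?_ fun H hH => ?_
  · change D.σ (D.θ D.Υ) = D.Υ
    rw [D.θ_Υ, D.σ_Υ]
  · rw [← lie_skew, D.lie_Υ_of_mem_k (R.t_le hH), neg_zero]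

/-- The adjoint of `ad H` is `-ad (θH)`, so `χ(H)` is minus the conjugate of `χ(θH)`; apply `θ` to
the eigenvalue equation for `θH`. -/
theorem θ_mem_weightSpace {χ : Module.Dual ℂ R.t.toSubmodule} {X : 𝔤}
    (hX : X ∈ weightSpace R.t.toSubmodule χ) : D.θ X ∈ weightSpace R.t.toSubmodule (-χ) := by
  rcases eq_or_ne X 0 with rfl | h0
  · rw [map_zero]
    exact zero_mem _
  intro H
  have hθ : D.θ H ∈ R.t := R.t_stable _ H.2
  have h₁ : ⁅(H : 𝔤), X⁆ = χ H • X := hX H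
  have h₂ : ⁅D.θ H, X⁆ = χ ⟨D.θ H, hθ⟩ • X := hX ⟨D.θ H, hθ⟩
  have h₃ : χ H = -starRingEnd ℂ (χ ⟨D.θ H, hθ⟩) := by
    have h := D.form_lie_left H X X
    rw [h₁, h₂, D.form_smul_left, D.form_smul_right, ← neg_mul] at h
    exact mul_right_cancel₀ (fun hf => h0 (D.eq_zero_of_form_self hf)) h
  have h₄ := congrArg D.θ h₂
  rw [D.θ_lie, D.θ_invol, D.θ_smul] at h₄
  rw [h₄, LinearMap.neg_apply, h₃, neg_neg]

theorem e_mem_mPlus (ψ : R.Ψ) : R.e ψ ∈ D.mPlus :=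
  (R.maximal.prop.1 _ ψ.2).2 (R.e_mem ψ)

theorem e_ne_zero (ψ : R.Ψ) : R.e ψ ≠ 0 := by
  intro h
  exact (R.triple ψ).h_ne_zero (by rw [h, zero_lie])

theorem lie_h_e (ψ : R.Ψ) : ⁅R.h ψ, R.e ψ⁆ = (2 : ℂ) • R.e ψ := by
  rw [h, (R.triple ψ).lie_h_e_nsmul]
  module

theorem lie_h_σ_e (ψ : R.Ψ) : ⁅R.h ψ, D.σ (R.e ψ)⁆ = (-2 : ℂ) • D.σ (R.e ψ) := by
  rw [h, (R.triple ψ).lie_h_f_nsmul]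
  module

theorem σ_e_mem_weightSpace (ψ : R.Ψ) :
    D.σ (R.e ψ) ∈ weightSpace R.t.toSubmodule (-(ψ : Module.Dual ℂ R.t.toSubmodule)) := by
  rw [← neg_neg (D.σ (R.e ψ)), ← D.θ_eq_of_mem_mPlus (R.e_mem_mPlus ψ)]
  exact neg_mem (R.θ_mem_weightSpace (R.e_mem ψ))

theorem σ_h (ψ : R.Ψ) : D.σ (R.h ψ) = -R.h ψ := by
  rw [h, D.σ_lie, D.σ_invol, lie_skew]

theorem θ_h (ψ : R.Ψ) : D.θ (R.h ψ) = -R.h ψ := by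
  rw [h, D.θ_lie, D.θ_eq_of_mem_mPlus (R.e_mem_mPlus ψ), D.θ_σ_of_mem_mPlus (R.e_mem_mPlus ψ),
    neg_lie, lie_neg, neg_neg, lie_skew]

theorem h_mem_t (ψ : R.Ψ) : R.h ψ ∈ R.t := by
  refine R.mem_t_of_centralizes ?_ fun H hH => ?_
  · change D.σ (D.θ (R.h ψ)) = R.h ψ
    rw [θ_h, map_neg, σ_h, neg_neg]
  · have h₁ := R.e_mem ψ ⟨H, hH⟩
    have h₂ := R.σ_e_mem_weightSpace ψ ⟨H, hH⟩
    have := lie_lie_of_eigen h₁ h₂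
    rw [h, this]
    simp

theorem lie_e_σ_e {ψ φ : R.Ψ} (hne : ψ ≠ φ) : ⁅R.e ψ, D.σ (R.e φ)⁆ = 0 := by
  have hne' : (ψ : Module.Dual ℂ R.t.toSubmodule) ≠ φ := fun h => hne (Subtype.ext h)
  have hroot := (R.maximal.prop.2 _ ψ.2 _ φ.2 hne').2
  by_contra h0
  refine hroot ⟨sub_ne_zero.2 hne', fun hbot => h0 ?_⟩
  rw [← Submodule.mem_bot ℂ, ← hbot]
  intro H
  rw [lie_lie_of_eigen (R.e_mem ψ H) (R.σ_e_mem_weightSpace φ H)]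
  simp [sub_eq_add_neg]

theorem lie_h_σ_e_of_ne {ψ φ : R.Ψ} (hne : ψ ≠ φ) : ⁅R.h ψ, D.σ (R.e φ)⁆ = 0 := by
  rw [h, lie_lie, D.lie_σ_eq_zero_of_mem_mPlus (R.e_mem_mPlus ψ) (R.e_mem_mPlus φ),
    R.lie_e_σ_e hne, lie_zero, lie_zero, sub_zero]

variable [FiniteDimensional ℂ 𝔤]

theorem lie_h_h (ψ φ : R.Ψ) : ⁅R.h ψ, R.h φ⁆ = 0 :=
  R.lie_eq_zero_of_mem_t (R.h_mem_t ψ) (R.h_mem_t φ)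

/-- The part of `𝔪⁺` centralized by all `h_ψ`, as a module over `𝔱`. -/
def centralizerPart : LieSubmodule ℂ R.t 𝔤 where
  carrier := {X | X ∈ D.mPlus ∧ ∀ ψ, ⁅R.h ψ, X⁆ = 0}
  add_mem' := by
    rintro a b ⟨ha, ha'⟩ ⟨hb, hb'⟩
    exact ⟨add_mem ha hb, fun ψ => by rw [lie_add, ha', hb', add_zero]⟩
  zero_mem' := ⟨zero_mem _, fun ψ => lie_zero _⟩
  smul_mem' := by
    rintro c X ⟨hX, hX'⟩
    exact ⟨D.mPlus.smul_mem c hX, fun ψ => by rw [lie_smul, hX', smul_zero]⟩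
  lie_mem := by
    rintro ⟨H, hH⟩ X ⟨hX, hX'⟩
    change ⁅H, X⁆ ∈ D.mPlus ∧ ∀ ψ, ⁅R.h ψ, ⁅H, X⁆⁆ = 0
    refine ⟨?_, fun ψ => ?_⟩
    · rw [D.mem_mPlus_iff, leibniz_lie, D.lie_Υ_of_mem_k (R.t_le hH), zero_lie, zero_add,
        D.mem_mPlus_iff.1 hX, lie_smul]
    · rw [leibniz_lie, R.lie_eq_zero_of_mem_t (R.h_mem_t ψ) hH, hX', zero_lie, lie_zero, add_zero]

theorem exists_weight_of_centralizerPart_ne_bot (h : R.centralizerPart ≠ ⊥) :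
    ∃ (χ : Module.Dual ℂ R.t.toSubmodule) (X : 𝔤), X ≠ 0 ∧ X ∈ weightSpace R.t.toSubmodule χ ∧
      X ∈ D.mPlus ∧ ∀ ψ, ⁅R.h ψ, X⁆ = 0 := by
  have : IsLieAbelian R.t :=
    ⟨fun H H' => Subtype.ext (R.lie_eq_zero_of_mem_t H.2 H'.2)⟩
  have : Nontrivial R.centralizerPart := (LieSubmodule.nontrivial_iff_ne_bot ℂ R.t 𝔤).2 h
  obtain ⟨χ, hχ⟩ := LieModule.exists_nontrivial_weightSpace_of_isNilpotent ℂ R.t R.centralizerPart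
  obtain ⟨⟨X, hX⟩, hX0⟩ := exists_ne (0 : LieModule.weightSpace R.centralizerPart χ)
  refine ⟨χ, X, fun h0 => hX0 (Subtype.ext (Subtype.ext h0)), fun H => ?_, X.2.1, X.2.2⟩
  have := (LieModule.mem_weightSpace _ _).1 hX H
  exact congrArg Subtype.val this

/-- The maximality of `Ψ` implies that no nonzero vector of `𝔪⁺` is centralized by `𝔱⁻`. -/
theorem eq_zero_of_forall_lie_h {A : 𝔤} (hA : A ∈ D.mPlus) (h : ∀ ψ, ⁅R.h ψ, A⁆ = 0) : A = 0 := by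
  by_contra hA0
  have hne : R.centralizerPart ≠ ⊥ := by
    intro hbot
    have hmem : A ∈ R.centralizerPart := ⟨hA, h⟩
    rw [hbot, LieSubmodule.mem_bot] at hmem
    exact hA0 hmem
  obtain ⟨χ, X, hX0, hXχ, hXm, hXh⟩ := R.exists_weight_of_centralizerPart_ne_bot hne
  let υ : R.t.toSubmodule := ⟨D.Υ, R.Υ_mem_t⟩
  let η : R.Ψ → R.t.toSubmodule := fun ψ => ⟨R.h ψ, R.h_mem_t ψ⟩
  have hχΥ : χ υ = Complex.I :=
    smul_left_injective ℂ hX0 ((hXχ υ).symm.trans (D.mem_mPlus_iff.1 hXm))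
  have hχh : ∀ ψ, χ (η ψ) = 0 := fun ψ =>
    smul_left_injective ℂ hX0 ((hXχ (η ψ)).symm.trans ((hXh ψ).trans (zero_smul ℂ X).symm))
  have hψΥ : ∀ ψ : R.Ψ, ψ.1 υ = Complex.I := fun ψ =>
    smul_left_injective ℂ (R.e_ne_zero ψ)
      ((R.e_mem ψ υ).symm.trans (D.mem_mPlus_iff.1 (R.e_mem_mPlus ψ)))
  have hψh : ∀ ψ : R.Ψ, ψ.1 (η ψ) = 2 := fun ψ =>
    smul_left_injective ℂ (R.e_ne_zero ψ) ((R.e_mem ψ (η ψ)).symm.trans (R.lie_h_e ψ))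
  have hχ0 : χ ≠ 0 := by
    rintro rfl
    exact Complex.I_ne_zero hχΥ.symm
  have hle : weightSpace R.t.toSubmodule χ ≤ D.mPlus := by
    intro Y hY
    rw [D.mem_mPlus_iff, ← hχΥ]
    exact hY υ
  -- The aim is that `χ` can be adjoined to `Ψ`. A vector of weight `ψ + χ` would have
  -- `Υ`-eigenvalue `2i`.
  have hadd : ∀ ψ : R.Ψ, ¬ IsRoot R.t.toSubmodule (ψ.1 + χ) := by
    rintro ψ ⟨-, hne⟩
    obtain ⟨Y, hY, hY0⟩ := Submodule.exists_mem_ne_zero_of_ne_bot hne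
    refine hY0 (D.eq_zero_of_lie_Υ_two ((hY υ).trans ?_))
    rw [LinearMap.add_apply, hψΥ, hχΥ, two_mul]
  -- `Y` has `Υ`-eigenvalue `0`, so lowering it twice by `σ e_ψ` would give eigenvalue `-2i`, hence
  -- gives zero. But `χ(h_ψ) = 0` makes its `h_ψ`-weight `2`, where lowering twice is injective.
  have hsub_eq : ∀ ψ : R.Ψ, ∀ Y ∈ weightSpace R.t.toSubmodule (ψ.1 - χ), Y = 0 := by
    intro ψ Y hY
    have hYΥ : ⁅D.Υ, Y⁆ = (0 : ℂ) • Y := by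
      refine (hY υ).trans ?_
      rw [LinearMap.sub_apply, hψΥ, hχΥ, sub_self]
    refine D.eq_zero_of_lower_twice (R.e_mem_mPlus ψ) (R.triple ψ) ?_ ?_
    · refine (hY (η ψ)).trans ?_
      rw [LinearMap.sub_apply, hψh, hχh, sub_zero]
    · have hσ := D.lie_Υ_σ (R.e_mem_mPlus ψ)
      refine D.eq_zero_of_lie_Υ_neg_two ?_
      rw [lie_lie_of_eigen hσ (lie_lie_of_eigen hσ hYΥ)]
      congr 1
      ring
  have hsub : ∀ ψ : R.Ψ, ¬ IsRoot R.t.toSubmodule (ψ.1 - χ) := fun ψ hr =>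
    hr.2 ((Submodule.eq_bot_iff _).2 (hsub_eq ψ))
  have hsub' : ∀ ψ : R.Ψ, ¬ IsRoot R.t.toSubmodule (χ - ψ.1) := by
    rintro ψ ⟨-, hne⟩
    obtain ⟨Y, hY, hY0⟩ := Submodule.exists_mem_ne_zero_of_ne_bot hne
    have hθ := R.θ_mem_weightSpace hY
    rw [neg_sub] at hθ
    refine hY0 ?_
    rw [← D.θ_invol Y, hsub_eq ψ _ hθ, map_zero]
  have hins : IsStronglyOrthogonal D R.t.toSubmodule
      (insert χ (R.Ψ : Set (Module.Dual ℂ R.t.toSubmodule))) := by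
    constructor
    · rintro ψ (rfl | hψ)
      · exact ⟨⟨hχ0, fun hbot => hX0 ((Submodule.mem_bot ℂ).1 (hbot ▸ hXχ))⟩, hle⟩
      · exact R.maximal.prop.1 ψ hψ
    · rintro ψ (rfl | hψ) φ (rfl | hφ) hne
      · exact (hne rfl).elim
      · exact ⟨by rw [add_comm]; exact hadd ⟨φ, hφ⟩, hsub' ⟨φ, hφ⟩⟩
      · exact ⟨hadd ⟨ψ, hψ⟩, hsub ⟨ψ, hψ⟩⟩
      · exact R.maximal.prop.2 ψ hψ φ hφ hne
  -- Maximality puts `χ` in `Ψ`, where its value on its own `h` is `2`, while `χ` kills every `h_ψ`.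
  have hmem : χ ∈ R.Ψ := R.maximal.le_of_ge hins (Set.subset_insert _ _) (Set.mem_insert _ _)
  have h2 := (hψh ⟨χ, hmem⟩).symm.trans (hχh ⟨χ, hmem⟩)
  exact two_ne_zero h2

end RootChoice

/-! ### Semisimplicity of elements negated by `θ`. -/

namespace HermitianData

variable {𝔤 : Type*} [LieRing 𝔤] [LieAlgebra ℂ 𝔤] (D : HermitianData 𝔤)

/-- An element negated by `θ` acts semisimply: generalized eigenvectors are eigenvectors. -/
theorem lie_eq_of_mem_maxGenEigenspace {H X : 𝔤} (hH : D.θ H = -H) {μ : ℂ}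
    (hX : X ∈ (LieAlgebra.ad ℂ 𝔤 H).maxGenEigenspace μ) : ⁅H, X⁆ = μ • X := by
  have self_adj : ∀ Y Z : 𝔤, D.form ⁅H, Y⁆ Z = D.form Y ⁅H, Z⁆ := by
    intro Y Z
    rw [D.form_lie_left, hH, neg_lie, D.form_neg_right, neg_neg]
  -- If the eigenvector `W = (ad H - μ)Y` were nonzero, self-adjointness would make `μ` real, and
  -- then `|W|² = form Y ((ad H - μ)W) = 0`.
  have sq : ∀ Y : 𝔤, ⁅H, ⁅H, Y⁆ - μ • Y⁆ = μ • (⁅H, Y⁆ - μ • Y) → ⁅H, Y⁆ = μ • Y := by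
    intro Y hY
    set W := ⁅H, Y⁆ - μ • Y with hW
    rw [← sub_eq_zero, ← hW]
    by_contra h0
    have hreal : μ = starRingEnd ℂ μ := by
      have := self_adj W W
      rw [hY, D.form_smul_left, D.form_smul_right] at this
      exact mul_right_cancel₀ (fun hf => h0 (D.eq_zero_of_form_self hf)) this
    refine h0 (D.eq_zero_of_form_self ?_)
    have hsub : ∀ V : 𝔤, D.form (⁅H, Y⁆ - μ • Y) V = D.form ⁅H, Y⁆ V - μ * D.form Y V := by
      intro V
      rw [← D.form_smul_left]
      simp only [form, map_sub, LinearMap.sub_apply]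
      ring
    nth_rewrite 1 [hW]
    rw [hsub, self_adj, hY, D.form_smul_right, ← hreal, sub_self]
  obtain ⟨n, hn⟩ := (Module.End.mem_maxGenEigenspace _ _ _).1 hX
  induction n generalizing X with
  | zero =>
    have h0 : X = 0 := by simpa using hn
    rw [h0, lie_zero, smul_zero]
  | succ n ih =>
    rw [pow_succ, Module.End.mul_apply] at hn
    have h := ih ((Module.End.mem_maxGenEigenspace _ _ _).2 ⟨n, hn⟩) hn
    simp only [LinearMap.sub_apply, LinearMap.smul_apply, Module.End.one_apply,
      LieAlgebra.ad_apply] at h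
    exact sq X h

end HermitianData

/-! ### Decomposition into restricted root spaces. -/

namespace RootChoice

variable {𝔤 : Type*} [LieRing 𝔤] [LieAlgebra ℂ 𝔤] {D : HermitianData 𝔤} (R : RootChoice D)

/-- `h_ψ` as an element of `𝔱⁻`. -/
def hMem (ψ : R.Ψ) : R.tMinus := ⟨R.h ψ, Submodule.subset_span ⟨ψ, rfl⟩⟩

theorem coe_hSum (c : R.Ψ → ℝ) : (R.hSum c : 𝔤) = ∑ ψ, (c ψ : ℂ) • R.h ψ := by
  simp [hSum]

theorem span_hMem : Submodule.span ℂ (Set.range R.hMem) = ⊤ := by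
  have : Set.range R.hMem = ((↑) : R.tMinus → 𝔤) ⁻¹' Set.range R.h := by
    ext x
    constructor
    · rintro ⟨ψ, rfl⟩
      exact ⟨ψ, rfl⟩
    · rintro ⟨ψ, hψ⟩
      exact ⟨ψ, Subtype.ext hψ⟩
  rw [this]
  exact Submodule.span_span_coe_preimage

/-- A simultaneous eigenvector of the `h_ψ` is a weight vector of `𝔱⁻`. -/
theorem exists_mem_weightSpace {X : 𝔤} (hX0 : X ≠ 0) (h : ∀ ψ, ∃ a : ℂ, ⁅R.h ψ, X⁆ = a • X) :
    ∃ α, X ∈ weightSpace R.tMinus α := by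
  have hall : ∀ H : R.tMinus, ∃ a : ℂ, ⁅(H : 𝔤), X⁆ = a • X := by
    rintro ⟨H, hH⟩
    change ∃ a : ℂ, ⁅H, X⁆ = a • X
    refine Submodule.span_induction ?_ ?_ ?_ ?_ hH
    · rintro _ ⟨ψ, rfl⟩
      exact h ψ
    · exact ⟨0, by rw [zero_lie, zero_smul]⟩
    · rintro x y - - ⟨a, ha⟩ ⟨b, hb⟩
      exact ⟨a + b, by rw [add_lie, ha, hb, add_smul]⟩
    · rintro r x - ⟨a, ha⟩
      exact ⟨r * a, by rw [smul_lie, ha, smul_smul]⟩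
  choose a ha using hall
  have inj := smul_left_injective ℂ hX0
  refine ⟨{ toFun := a, map_add' := fun x y => inj ?_, map_smul' := fun r x => inj ?_ }, ha⟩
  · change a (x + y) • X = (a x + a y) • X
    rw [← ha, add_smul, ← ha, ← ha, Submodule.coe_add, add_lie]
  · change a (r • x) • X = (r * a x) • X
    rw [← ha, mul_smul, ← ha, Submodule.coe_smul, smul_lie]

/-- `∑ c_ψ e_ψ`. -/
def eSum (c : R.Ψ → ℝ) : 𝔤 := ∑ ψ, (c ψ : ℂ) • R.e ψ

theorem eSum_mem_mPlus (c : R.Ψ → ℝ) : R.eSum c ∈ D.mPlus :=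
  sum_mem fun ψ _ => D.mPlus.smul_mem _ (R.e_mem_mPlus ψ)

theorem σ_eSum (c : R.Ψ → ℝ) : D.σ (R.eSum c) = ∑ ψ, (c ψ : ℂ) • D.σ (R.e ψ) := by
  simp only [eSum, map_sum, D.σ_smul, Complex.conj_ofReal]

theorem xSum_eq (c : R.Ψ → ℝ) : R.xSum c = R.eSum c + D.σ (R.eSum c) := by
  rw [σ_eSum, eSum, ← Finset.sum_add_distrib, xSum]
  refine Finset.sum_congr rfl fun ψ _ => ?_
  rw [x, ← Complex.coe_smul, smul_add]

/-- Off-diagonal brackets vanish by strong orthogonality: `ψ - φ` is not a root. -/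
theorem lie_eSum_σ_eSum (c d : R.Ψ → ℝ) :
    ⁅R.eSum c, D.σ (R.eSum d)⁆ = (R.hSum fun ψ => c ψ * d ψ : 𝔤) := by
  classical
  rw [coe_hSum, σ_eSum, eSum, sum_lie]
  refine Finset.sum_congr rfl fun ψ _ => ?_
  rw [lie_sum, Finset.sum_eq_single ψ]
  · rw [smul_lie, lie_smul, smul_smul, h]
    push_cast
    rfl
  · intro φ _ hne
    rw [smul_lie, lie_smul, R.lie_e_σ_e hne.symm, smul_zero, smul_zero]
  · simp

theorem lie_hSum_σ_eSum (c d : R.Ψ → ℝ) :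
    ⁅(R.hSum c : 𝔤), D.σ (R.eSum d)⁆ = (-2 : ℂ) • D.σ (R.eSum fun ψ => c ψ * d ψ) := by
  classical
  rw [coe_hSum, σ_eSum, σ_eSum, sum_lie, Finset.smul_sum]
  refine Finset.sum_congr rfl fun ψ _ => ?_
  rw [lie_sum, Finset.sum_eq_single ψ]
  · rw [smul_lie, lie_smul, R.lie_h_σ_e]
    push_cast
    module
  · intro φ _ hne
    rw [smul_lie, lie_smul, R.lie_h_σ_e_of_ne hne.symm, smul_zero, smul_zero]
  · simp

/-- `𝔪⁺_{ν₁,ν₂}` is a simultaneous eigenspace of two elements of `𝔱⁻` on `𝔪⁺`. -/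
theorem mem_mPlusJoint_xSum_iff (c : R.Ψ → ℝ) (ν₁ ν₂ : ℝ) {A : 𝔤} :
    A ∈ D.mPlusJoint (R.xSum c) ν₁ ν₂ ↔ A ∈ D.mPlus ∧
      ⁅(R.hSum fun ψ => c ψ ^ 2 : 𝔤), A⁆ = (((ν₁ + ν₂) / 2 : ℝ) : ℂ) • A ∧
      ⁅(R.hSum fun ψ => c ψ ^ 4 : 𝔤), A⁆ =
        (((ν₁ ^ 2 + 6 * ν₁ * ν₂ + ν₂ ^ 2) / 8 : ℝ) : ℂ) • A := by
  have h₂ : ⁅R.eSum c, D.σ (R.eSum c)⁆ = (R.hSum fun ψ => c ψ ^ 2 : 𝔤) := by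
    rw [lie_eSum_σ_eSum]
    simp only [← pow_two]
  -- The factor `-2` is the `h_ψ`-weight of `σ e_ψ`; it cancels the `-2` in `mem_mPlusJoint_iff`.
  have h₄ : ⁅R.eSum c, ⁅(R.hSum fun ψ => c ψ ^ 2 : 𝔤), D.σ (R.eSum c)⁆⁆ =
      (-2 : ℂ) • (R.hSum fun ψ => c ψ ^ 4 : 𝔤) := by
    rw [lie_hSum_σ_eSum, lie_smul, lie_eSum_σ_eSum]
    simp only [show ∀ ψ, c ψ * (c ψ ^ 2 * c ψ) = c ψ ^ 4 from fun ψ => by ring]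
  rw [xSum_eq, D.mem_mPlusJoint_iff (R.eSum_mem_mPlus c), h₂, h₄, smul_lie, Complex.ofReal_mul,
    mul_smul, show (((-2 : ℝ)) : ℂ) = -2 by push_cast; rfl,
    (smul_right_injective 𝔤 (neg_ne_zero.2 two_ne_zero : (-2 : ℂ) ≠ 0)).eq_iff]

variable [FiniteDimensional ℂ 𝔤]

theorem commute_ad_h (ψ φ : R.Ψ) :
    Commute (LieAlgebra.ad ℂ 𝔤 (R.h ψ)) (LieAlgebra.ad ℂ 𝔤 (R.h φ)) := by
  refine LinearMap.ext fun X => ?_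
  simp only [Module.End.mul_apply, LieAlgebra.ad_apply]
  rw [leibniz_lie, R.lie_h_h, zero_lie, zero_add]

/-- A weight of `𝔱⁻` is determined by its values on the `h_ψ`, so independence is inherited from the
joint generalized eigenspaces of the commuting `ad h_ψ`. -/
theorem iSupIndep_mPlusRoot : iSupIndep R.mPlusRoot := by
  have hind := Module.End.independent_iInf_maxGenEigenspace_of_forall_mapsTo
    (fun ψ : R.Ψ => LieAlgebra.ad ℂ 𝔤 (R.h ψ))
    (fun ψ φ a => Module.End.mapsTo_maxGenEigenspace_of_comm (R.commute_ad_h φ ψ) a)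
  have hinj : Function.Injective
      (fun (α : Module.Dual ℂ R.tMinus) (ψ : R.Ψ) => α (R.hMem ψ)) := by
    intro α β hαβ
    refine LinearMap.ext_on_range R.span_hMem fun ψ => congrFun hαβ ψ
  refine (hind.comp hinj).mono fun α X hX => ?_
  refine (Submodule.mem_iInf _).2 fun ψ => ?_
  refine Module.End.eigenspace_le_maxGenEigenspace ?_
  rw [Module.End.mem_eigenspace_iff]
  exact hX.1 (R.hMem ψ)

/-- The left side is a joint eigenspace `W` in `𝔪⁺`, stable under the commuting `ad h_ψ`, so it is
spanned by their joint generalized eigenvectors. These are genuine eigenvectors by semisimplicity,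
hence weight vectors of `𝔱⁻`. -/
theorem mPlusJoint_eq_iSup (c : R.Ψ → ℝ) (ν₁ ν₂ : ℝ) :
    D.mPlusJoint (R.xSum c) ν₁ ν₂ =
      (⨆ α : R.eigenRoots c ν₁ ν₂, R.mPlusRoot α).restrictScalars ℝ := by
  set s : ℂ := (((ν₁ + ν₂) / 2 : ℝ) : ℂ) with hs
  set r : ℂ := (((ν₁ ^ 2 + 6 * ν₁ * ν₂ + ν₂ ^ 2) / 8 : ℝ) : ℂ) with hr
  let W : Submodule ℂ 𝔤 := D.mPlus ⊓
    ((LieAlgebra.ad ℂ 𝔤 (R.hSum fun ψ => c ψ ^ 2 : 𝔤)).eigenspace s ⊓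
      (LieAlgebra.ad ℂ 𝔤 (R.hSum fun ψ => c ψ ^ 4 : 𝔤)).eigenspace r)
  have hW : ∀ A, A ∈ W ↔ A ∈ D.mPlus ∧ ⁅(R.hSum fun ψ => c ψ ^ 2 : 𝔤), A⁆ = s • A ∧
      ⁅(R.hSum fun ψ => c ψ ^ 4 : 𝔤), A⁆ = r • A := by
    intro A
    simp only [W, Submodule.mem_inf, Module.End.mem_eigenspace_iff, LieAlgebra.ad_apply]
  suffices hsup : W = ⨆ α : R.eigenRoots c ν₁ ν₂, R.mPlusRoot α by
    ext A
    rw [Submodule.restrictScalars_mem, ← hsup, hW, R.mem_mPlusJoint_xSum_iff]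
  apply le_antisymm
  · have hcomm : ∀ (ψ : R.Ψ) (d : R.Ψ → ℝ) (A : 𝔤),
        ⁅(R.hSum d : 𝔤), ⁅R.h ψ, A⁆⁆ = ⁅R.h ψ, ⁅(R.hSum d : 𝔤), A⁆⁆ := by
      intro ψ d A
      have h0 : ⁅(R.hSum d : 𝔤), R.h ψ⁆ = 0 := by
        rw [coe_hSum, sum_lie]
        exact Finset.sum_eq_zero fun φ _ => by rw [smul_lie, R.lie_h_h, smul_zero]
      rw [leibniz_lie, h0, zero_lie, zero_add]
    have hmaps : ∀ ψ : R.Ψ, Set.MapsTo (LieAlgebra.ad ℂ 𝔤 (R.h ψ)) W W := by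
      intro ψ A hA
      obtain ⟨h₁, h₂, h₃⟩ := (hW A).1 hA
      refine (hW _).2 ⟨?_, ?_, ?_⟩
      · rw [LieAlgebra.ad_apply, D.mem_mPlus_iff, leibniz_lie,
          D.lie_Υ_of_mem_k (R.t_le (R.h_mem_t ψ)), zero_lie, zero_add, D.mem_mPlus_iff.1 h₁,
          lie_smul]
      · rw [LieAlgebra.ad_apply, hcomm, h₂, lie_smul]
      · rw [LieAlgebra.ad_apply, hcomm, h₃, lie_smul]
    have htop := Module.End.iSup_iInf_maxGenEigenspace_eq_top_of_iSup_maxGenEigenspace_eq_top_of_commute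
      (fun ψ : R.Ψ => (LieAlgebra.ad ℂ 𝔤 (R.h ψ)).restrict (hmaps ψ))
      (fun ψ φ _ => LinearMap.ext fun X =>
        Subtype.ext (LinearMap.congr_fun (R.commute_ad_h ψ φ) (X : 𝔤)))
      (fun ψ => Module.End.iSup_maxGenEigenspace_eq_top _)
    have hWmap := congrArg (Submodule.map W.subtype) htop
    rw [Submodule.map_top, Submodule.range_subtype, Submodule.map_iSup] at hWmap
    rw [← hWmap]
    refine iSup_le fun χ => ?_
    rw [← Submodule.inf_iInf_maxGenEigenspace_of_forall_mapsTo]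
    rintro X ⟨hXW, hX⟩
    rcases eq_or_ne X 0 with rfl | hX0
    · exact zero_mem _
    have hXχ : ∀ ψ, ⁅R.h ψ, X⁆ = χ ψ • X := fun ψ =>
      D.lie_eq_of_mem_maxGenEigenspace (R.θ_h ψ) ((Submodule.mem_iInf _).1 hX ψ)
    obtain ⟨α, hα⟩ := R.exists_mem_weightSpace hX0 fun ψ => ⟨χ ψ, hXχ ψ⟩
    obtain ⟨h₁, h₂, h₃⟩ := (hW X).1 hXW
    have inj := smul_left_injective ℂ hX0
    have hmem : X ∈ R.mPlusRoot α := ⟨hα, h₁⟩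
    have hαmem : α ∈ R.eigenRoots c ν₁ ν₂ := by
      refine ⟨⟨⟨?_, ?_⟩, ?_⟩, inj ((hα _).symm.trans h₂), inj ((hα _).symm.trans h₃)⟩
      -- Weight zero is excluded by the maximality of `Ψ`.
      · rintro rfl
        refine hX0 (R.eq_zero_of_forall_lie_h h₁ fun ψ => ?_)
        exact (hα (R.hMem ψ)).trans (zero_smul ℂ X)
      · exact (Submodule.ne_bot_iff _).2 ⟨X, hα, hX0⟩
      · exact (Submodule.ne_bot_iff _).2 ⟨X, hmem, hX0⟩
    exact Submodule.mem_iSup_of_mem (p := fun α : R.eigenRoots c ν₁ ν₂ => R.mPlusRoot α)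
      ⟨α, hαmem⟩ hmem
  · refine iSup_le fun α X hX => (hW X).2 ⟨hX.2, ?_, ?_⟩
    · rw [hX.1 (R.hSum fun ψ => c ψ ^ 2), α.2.2.1]
    · rw [hX.1 (R.hSum fun ψ => c ψ ^ 4), α.2.2.2]

end RootChoice

end HermSym

end

theorem theorem6p2 {𝔤 : Type*} [LieRing 𝔤] [LieAlgebra ℂ 𝔤] [FiniteDimensional ℂ 𝔤]
    [LieAlgebra.IsSimple ℂ 𝔤] (D : HermSym.HermitianData 𝔤) :
    (∀ Z ∈ D.m₀, ∀ A ∈ D.m₀, A ≠ 0 → ∀ ν₁ ν₂ : ℝ,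
      ⁅Z, ⁅Z, A⁆⁆ = ν₁ • A → ⁅D.J Z, ⁅D.J Z, A⁆⁆ = ν₂ • A →
        (0 ≤ ν₁ ∧ 0 ≤ ν₂) ∧
        ((HermSym.E Z).HasEigenvector (HermSym.sinhc ν₁ : ℂ) A ∧
          (HermSym.E (D.J Z)).HasEigenvector (HermSym.sinhc ν₂ : ℂ) A ∧
          (HermSym.S Z).HasEigenvector (Real.cosh (Real.sqrt ν₁) : ℂ) A ∧
          (HermSym.S (D.J Z)).HasEigenvector (Real.cosh (Real.sqrt ν₂) : ℂ) A) ∧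
        ((HermSym.E Z).HasEigenvector (HermSym.sinhc ν₂ : ℂ) (D.J A) ∧
          (HermSym.E (D.J Z)).HasEigenvector (HermSym.sinhc ν₁ : ℂ) (D.J A) ∧
          (HermSym.S Z).HasEigenvector (Real.cosh (Real.sqrt ν₂) : ℂ) (D.J A) ∧
          (HermSym.S (D.J Z)).HasEigenvector (Real.cosh (Real.sqrt ν₁) : ℂ) (D.J A))) ∧
    (∀ (R : HermSym.RootChoice D) (c : R.Ψ → ℝ) (ν₁ ν₂ : ℝ),
      iSupIndep (fun α : R.eigenRoots c ν₁ ν₂ => R.mPlusRoot α) ∧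
      D.mPlusJoint (R.xSum c) ν₁ ν₂ =
        (⨆ α : R.eigenRoots c ν₁ ν₂, R.mPlusRoot α).restrictScalars ℝ) :=
  ⟨fun _ hZ _ hA hA0 _ _ h₁ h₂ => HermSym.hasEigenvector_E_S D hZ hA hA0 h₁ h₂,
    fun R c ν₁ ν₂ => ⟨R.iSupIndep_mPlusRoot.comp Subtype.val_injective,
      R.mPlusJoint_eq_iSup c ν₁ ν₂⟩⟩
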